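/- Let $n$ be a natural number and let $GL(n,\mathbb{C})$ carry its usual topology. Let $S \subseteq GL(n,\mathbb{C})$ be a nonempty closed subset that is closed under multiplication (a closed semigroup), and suppose that for every $T \in S$ the closure in $GL(n,\mathbb{C})$ of $\{T^m : m \in \mathbb{N},\ m \ge 1\}$ is compact. Then $S$ is a compact group, i.e. $S$ is a subgroup of $GL(n,\mathbb{C})$ and is compact. -/

import Mathlib

/-! Inverses are limits of positive powers, so `S` is a closed group `G` all of whose elements are
power bounded. What remains is a uniform norm bound on `G` (`exists_norm_le_of_isClosed`); a closed
bounded group of operators is compact. On an irreducible representation the bound is Burnside's: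
power boundedness bounds the traces of `g * h` uniformly in `g`, and the group spans all operators,
so all matrix coefficients are bounded. A completely reducible group is handled summand by summand,
so the point is to prove that `G` is completely reducible. This is done along a tower of subgroups.
The bottom is `connectedPart G`, which contains a neighbourhood of 1 in `G`. Elements of the Lie
algebra generate bounded flows, so they are semisimple with imaginary spectrum, and minus the real
trace form is positive definite and conjugation invariant. Its Casimir operator then yields
equivariant projections. The middle uses a conjugation trick. A sequence of conjugations shrinks the
off-diagonal blocks of `G` and converges to a bounded representation `ψ`. Finitely many elements
with `ψ g` near 1 can be conjugated simultaneously close to 1, where iterated commutators contract.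
They therefore generate a nilpotent group modulo `connectedPart G`; it is torsion, because every
element has a power near 1. Averaging over finite cyclic groups climbs its upper central series, and
finite dimensionality of the operator space passes from finite sets to arbitrary ones. At the top,
boundedness of `ψ` makes the subgroup so obtained of finite index, and Maschke averaging finishes.
-/

/-! ### Operators with imaginary spectrum and the trace of their square -/

/-- A complex operator with purely imaginary eigenvalues and no nilpotent part at `0`. -/
structure ImaginarySemisimple {E : Type*} [AddCommGroup E] [Module ℂ E]
    (T : Module.End ℂ E) : Prop where
  re_eq_zero : ∀ (c : ℂ) (v : E), v ≠ 0 → T v = c • v → c.re = 0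
  ker_sq : ∀ v : E, T (T v) = 0 → T v = 0

theorem Multiset.sum_map_re_nonpos {s : Multiset ℂ} (h : ∀ c ∈ s, c.re ≤ 0) :
    (s.map Complex.re).sum ≤ 0 := by
  induction s using Multiset.induction_on with
  | empty => simp
  | cons a s ih =>
    rw [Multiset.map_cons, Multiset.sum_cons]
    exact add_nonpos (h a (Multiset.mem_cons_self a s))
      (ih fun c hc => h c (Multiset.mem_cons_of_mem hc))

namespace ImaginarySemisimple

variable {E : Type*} [AddCommGroup E] [Module ℂ E] {T : Module.End ℂ E}

theorem restrict (hT : ImaginarySemisimple T) {W : Submodule ℂ E} (hW : ∀ w ∈ W, T w ∈ W) :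
    ImaginarySemisimple (T.restrict hW) where
  re_eq_zero c v hv h := hT.re_eq_zero c v (by simpa using hv) (by
    simpa using congrArg Subtype.val h)
  ker_sq v h := by
    have h1 := congrArg Subtype.val h
    exact Subtype.ext (hT.ker_sq v (by simpa using h1))

/-- Write `c = d ^ 2` and factor `T² - d² = (T - d)(T + d)`: either `v` is an eigenvector for `-d`,
or `T v + d • v` is one for `d`. So `d` is imaginary and its square is a nonpositive real. -/
theorem sq_eigenvalue (hT : ImaginarySemisimple T) {c : ℂ} {v : E} (hv : v ≠ 0)
    (h : T (T v) = c • v) : c.re ≤ 0 ∧ (c.re = 0 → c = 0) := by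
  obtain ⟨d, rfl⟩ := IsAlgClosed.exists_pow_nat_eq c two_pos
  have hd : d.re = 0 := by
    by_cases h1 : T v + d • v = 0
    · have := hT.re_eq_zero (-d) v hv (by rw [neg_smul]; exact eq_neg_of_add_eq_zero_left h1)
      simpa using this
    · refine hT.re_eq_zero d _ h1 ?_
      rw [map_add, map_smul, h, smul_add, smul_smul, add_comm, sq]
  have e : d ^ 2 = ((-(d.im ^ 2) : ℝ) : ℂ) := by
    apply Complex.ext <;> simp [sq, hd]
  rw [e]
  simp only [Complex.ofReal_re]
  exact ⟨by nlinarith [sq_nonneg d.im], fun h => by rw [h]; simp⟩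

theorem eq_zero_of_isNilpotent (hT : ImaginarySemisimple T) (h : IsNilpotent T) : T = 0 := by
  obtain ⟨n, hn⟩ := h
  have key : ∀ n : ℕ, T ^ (n + 1) = 0 → T = 0 := by
    intro n
    induction n with
    | zero => intro h; simpa using h
    | succ n ih =>
      intro h
      refine ih (LinearMap.ext fun v => ?_)
      have h2 := LinearMap.congr_fun h v
      rw [pow_succ', pow_succ'] at h2
      rw [pow_succ']
      exact hT.ker_sq _ h2
  exact key n (by rw [pow_succ, hn, zero_mul])

variable [FiniteDimensional ℂ E]

theorem roots_charpoly_sq (hT : ImaginarySemisimple T) {c : ℂ}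
    (hc : c ∈ (LinearMap.charpoly (T * T)).roots) : c.re ≤ 0 ∧ (c.re = 0 → c = 0) := by
  have h1 := Polynomial.isRoot_of_mem_roots hc
  rw [← Module.End.hasEigenvalue_iff_isRoot_charpoly] at h1
  obtain ⟨v, hv⟩ := h1.exists_hasEigenvector
  exact hT.sq_eigenvalue hv.2 (by simpa using hv.apply_eq_smul)

theorem trace_sq_re (T : Module.End ℂ E) : (LinearMap.trace ℂ E (T * T)).re =
    ((LinearMap.charpoly (T * T)).roots.map Complex.re).sum := by
  rw [Module.End.trace_eq_sum_roots_charpoly_of_splits (IsAlgClosed.splits _)]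
  exact map_multiset_sum Complex.reAddGroupHom _

theorem trace_sq_re_nonpos (hT : ImaginarySemisimple T) :
    (LinearMap.trace ℂ E (T * T)).re ≤ 0 := by
  rw [trace_sq_re]
  exact Multiset.sum_map_re_nonpos fun c hc => (hT.roots_charpoly_sq hc).1

/-- The eigenvalues of `T * T` have nonpositive real parts, so a vanishing sum forces each to
vanish. Then `T` is nilpotent, and the kernel condition rules out a nonzero nilpotent. -/
theorem eq_zero_of_trace_sq (hT : ImaginarySemisimple T)
    (h : (LinearMap.trace ℂ E (T * T)).re = 0) : T = 0 := by
  have hz : ∀ c ∈ (LinearMap.charpoly (T * T)).roots, c = 0 := by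
    intro c hc
    refine (hT.roots_charpoly_sq hc).2 ?_
    rw [trace_sq_re] at h
    by_contra hne
    have hlt : c.re < 0 := lt_of_le_of_ne (hT.roots_charpoly_sq hc).1 hne
    obtain ⟨s, hs⟩ := Multiset.exists_cons_of_mem hc
    rw [hs, Multiset.map_cons, Multiset.sum_cons] at h
    have : (s.map Complex.re).sum ≤ 0 := Multiset.sum_map_re_nonpos fun c' hc' =>
      (hT.roots_charpoly_sq (hs ▸ Multiset.mem_cons_of_mem hc')).1
    linarith
  refine hT.eq_zero_of_isNilpotent ?_
  have hsplit := (IsAlgClosed.splits (LinearMap.charpoly (T * T))).eq_prod_roots_of_monic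
    (LinearMap.charpoly_monic _)
  have hrep := Multiset.eq_replicate_card.2 hz
  rw [hrep] at hsplit
  simp only [Multiset.map_replicate, map_zero, sub_zero, Multiset.prod_replicate] at hsplit
  have h3 := LinearMap.aeval_self_charpoly (T * T)
  rw [hsplit] at h3
  simp only [map_pow, Polynomial.aeval_X] at h3
  rw [← sq, ← pow_mul] at h3
  exact ⟨_, h3⟩

end ImaginarySemisimple

/-! ### Orthonormal bases and the Casimir splitting -/

section Orthonormal

variable {𝔤 : Type*} [AddCommGroup 𝔤] [Module ℝ 𝔤]

theorem exists_basis_orthonormal [FiniteDimensional ℝ 𝔤] (B : 𝔤 →ₗ[ℝ] 𝔤 →ₗ[ℝ] ℝ)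
    (hsymm : ∀ x y, B x y = B y x) (hpos : ∀ x, x ≠ 0 → 0 < B x x) :
    ∃ b : Module.Basis (Fin (Module.finrank ℝ 𝔤)) ℝ 𝔤,
      ∀ i j, B (b i) (b j) = if i = j then 1 else 0 := by
  let core : InnerProductSpace.Core ℝ 𝔤 :=
    { inner := fun x y => B x y
      conj_inner_symm := fun x y => by simp [hsymm x y]
      re_inner_nonneg := fun x => by
        by_cases h : x = 0
        · simp [h]
        · exact (hpos x h).le
      add_left := fun x y z => by simp
      smul_left := fun x y r => by simp
      definite := fun x h => by
        by_contra hx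
        exact (hpos x hx).ne' h }
  let _ := core.toNormedAddCommGroup
  let _ := InnerProductSpace.ofCore core.toCore
  refine ⟨(stdOrthonormalBasis ℝ 𝔤).toBasis, fun i j => ?_⟩
  have := orthonormal_iff_ite.1 (stdOrthonormalBasis ℝ 𝔤).orthonormal i j
  rw [OrthonormalBasis.coe_toBasis]
  exact this

/-- The matrix of inner products of the `a (b i)` with the basis is orthogonal, which is all that
the double sum sees; linearity of `a` plays no role. This gives independence of the Casimir operator
from the orthonormal basis. -/
theorem sum_apply_isometry {ι M : Type*} [Fintype ι] [DecidableEq ι] [AddCommGroup M] [Module ℝ M]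
    {B : 𝔤 →ₗ[ℝ] 𝔤 →ₗ[ℝ] ℝ} {b : Module.Basis ι ℝ 𝔤}
    (hb : ∀ i j, B (b i) (b j) = if i = j then 1 else 0)
    (f : 𝔤 →ₗ[ℝ] 𝔤 →ₗ[ℝ] M) (a : 𝔤 → 𝔤) (ha : ∀ x y, B (a x) (a y) = B x y) :
    ∑ i, f (a (b i)) (a (b i)) = ∑ i, f (b i) (b i) := by
  let O : Matrix ι ι ℝ := fun i j => B (a (b i)) (b j)
  have hexp : ∀ x, x = ∑ j, B x (b j) • b j := by
    intro x
    conv_lhs => rw [← b.sum_repr x]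
    refine Finset.sum_congr rfl fun j _ => ?_
    congr 1
    calc b.repr x j = B (∑ k, b.repr x k • b k) (b j) := by
          simp [hb, LinearMap.sum_apply, -Module.Basis.sum_repr]
      _ = B x (b j) := by rw [b.sum_repr]
  have hO : O * O.transpose = 1 := by
    ext i k
    have h1 := ha (b i) (b k)
    rw [hb] at h1
    rw [Matrix.one_apply, ← h1, Matrix.mul_apply]
    conv_rhs => rw [hexp (a (b k))]
    simp only [map_sum, map_smul, smul_eq_mul]
    exact Finset.sum_congr rfl fun j _ => mul_comm _ _
  have hO' : O.transpose * O = 1 := mul_eq_one_comm.1 hO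
  have hO2 : ∀ j k, ∑ i, O i j * O i k = if j = k then 1 else 0 := by
    intro j k
    have := congrFun (congrFun hO' j) k
    rwa [Matrix.mul_apply, Matrix.one_apply] at this
  calc ∑ i, f (a (b i)) (a (b i)) = ∑ i, ∑ j, ∑ k, (O i j * O i k) • f (b j) (b k) := by
        refine Finset.sum_congr rfl fun i _ => ?_
        conv_lhs => rw [hexp (a (b i))]
        simp only [map_sum, map_smul, LinearMap.sum_apply, LinearMap.smul_apply, Finset.smul_sum,
          smul_smul]
        rw [Finset.sum_comm]
        refine Finset.sum_congr rfl fun j _ => Finset.sum_congr rfl fun k _ => ?_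
        simp only [O, mul_comm]
    _ = ∑ j, ∑ k, (∑ i, O i j * O i k) • f (b j) (b k) := by
        rw [Finset.sum_comm]
        refine Finset.sum_congr rfl fun j _ => ?_
        rw [Finset.sum_comm]
        refine Finset.sum_congr rfl fun k _ => ?_
        rw [Finset.sum_smul]
    _ = ∑ i, f (b i) (b i) := by
        simp [hO2]

end Orthonormal

/-- Fitting decomposition of the Casimir operator `Ω`. On its generalised kernel `Ω` is nilpotent,
so its trace is zero; that trace is a sum of traces of squares with nonpositive real parts, so each
`ρ (b i)` vanishes there. -/
theorem exists_fixed_add_range {𝔤 E ι : Type*} [Fintype ι] [AddCommGroup 𝔤] [Module ℝ 𝔤]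
    [AddCommGroup E] [Module ℂ E] [FiniteDimensional ℂ E] (ρ : 𝔤 →ₗ[ℝ] Module.End ℂ E)
    (hρ : ∀ x, ImaginarySemisimple (ρ x)) (b : Module.Basis ι ℝ 𝔤)
    (hcomm : ∀ x, Commute (∑ i, ρ (b i) * ρ (b i)) (ρ x)) (z : E) :
    ∃ z₀ : E, (∀ x, ρ x z₀ = 0) ∧ ∃ y, z = z₀ + (∑ i, ρ (b i) * ρ (b i)) y := by
  set Ω := ∑ i, ρ (b i) * ρ (b i) with hΩ
  -- The bound `1 ≤ N` lets one factor `Ω` be split off `Ω ^ N` at the end.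
  obtain ⟨N, hN, hN1⟩ := ((LinearMap.eventually_isCompl_ker_pow_range_pow Ω).and
    (Filter.eventually_ge_atTop 1)).exists
  have hinv : ∀ x, ∀ w ∈ LinearMap.ker (Ω ^ N), ρ x w ∈ LinearMap.ker (Ω ^ N) := by
    intro x w hw
    rw [LinearMap.mem_ker] at hw ⊢
    rw [← Module.End.mul_apply, ((hcomm x).pow_left N).eq, Module.End.mul_apply, hw, map_zero]
  have hinvΩ : ∀ w ∈ LinearMap.ker (Ω ^ N), Ω w ∈ LinearMap.ker (Ω ^ N) := by
    intro w hw
    rw [LinearMap.mem_ker] at hw ⊢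
    rw [← Module.End.mul_apply, ((Commute.refl Ω).pow_left N).eq, Module.End.mul_apply, hw,
      map_zero]
  have hnil : IsNilpotent (Ω.restrict hinvΩ) := by
    refine ⟨N, ?_⟩
    rw [Module.End.pow_restrict]
    ext w
    simp
  have hsum : Ω.restrict hinvΩ = ∑ i, (ρ (b i)).restrict (hinv (b i)) *
      (ρ (b i)).restrict (hinv (b i)) := by
    ext w
    simp [hΩ, LinearMap.sum_apply]
  have htr : (LinearMap.trace ℂ _ (Ω.restrict hinvΩ)).re = 0 := by
    have := (LinearMap.isNilpotent_trace_of_isNilpotent hnil).eq_zero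
    rw [this, Complex.zero_re]
  rw [hsum, map_sum, Complex.re_sum] at htr
  have hz := (Finset.sum_eq_zero_iff_of_nonpos fun i _ =>
    ((hρ (b i)).restrict (hinv (b i))).trace_sq_re_nonpos).1 htr
  have hker : ∀ w ∈ LinearMap.ker (Ω ^ N), ∀ x, ρ x w = 0 := by
    intro w hw x
    have hb : ∀ i, ρ (b i) w = 0 := by
      intro i
      have := ((hρ (b i)).restrict (hinv (b i))).eq_zero_of_trace_sq (hz i (Finset.mem_univ i))
      simpa using congrArg Subtype.val (LinearMap.congr_fun this ⟨w, hw⟩)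
    rw [← b.sum_repr x, map_sum, LinearMap.sum_apply]
    exact Finset.sum_eq_zero fun i _ => by
      rw [map_smul, LinearMap.smul_apply, hb, smul_zero]
  have hz' : z ∈ LinearMap.ker (Ω ^ N) ⊔ LinearMap.range (Ω ^ N) := by
    rw [hN.sup_eq_top]; trivial
  obtain ⟨z₀, hz₀, r, ⟨y, rfl⟩, rfl⟩ := Submodule.mem_sup.1 hz'
  refine ⟨z₀, hker z₀ hz₀, (Ω ^ (N - 1)) y, ?_⟩
  obtain ⟨k, rfl⟩ := Nat.exists_eq_add_of_le' hN1
  rw [Nat.add_sub_cancel, pow_succ', Module.End.mul_apply]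

/-! ### One-parameter subgroups and the Lie algebra of a closed subgroup -/

section OneParameter

open NormedSpace Filter Topology

variable {A : Type*} [NormedRing A] [NormedAlgebra ℝ A] [CompleteSpace A]

/-- The one-parameter group generated by `Y`, at time `t`. -/
noncomputable def oneParam (Y : A) (t : ℝ) : Aˣ :=
  let _ : NormedAlgebra ℚ A := .restrictScalars ℚ ℝ A
  { val := exp (t • Y)
    inv := exp (-t • Y)
    val_inv := by
      rw [← exp_add_of_commute, ← add_smul, add_neg_cancel, zero_smul, exp_zero]
      exact ((Commute.refl Y).smul_left _).smul_right _
    inv_val := by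
      rw [← exp_add_of_commute, ← add_smul, neg_add_cancel, zero_smul, exp_zero]
      exact ((Commute.refl Y).smul_left _).smul_right _ }

theorem val_oneParam (Y : A) (t : ℝ) : (oneParam Y t : A) = exp (t • Y) := rfl

theorem oneParam_inv (Y : A) (t : ℝ) : (oneParam Y t)⁻¹ = oneParam Y (-t) := Units.ext rfl

theorem oneParam_zero (Y : A) : oneParam Y 0 = 1 :=
  Units.ext (by rw [val_oneParam, zero_smul, exp_zero, Units.val_one])

theorem oneParam_smul (Y : A) (s t : ℝ) : oneParam (s • Y) t = oneParam Y (t * s) :=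
  Units.ext (by rw [val_oneParam, val_oneParam, smul_smul])

theorem oneParam_add (Y : A) (s t : ℝ) : oneParam Y (s + t) = oneParam Y s * oneParam Y t := by
  let _ : NormedAlgebra ℚ A := .restrictScalars ℚ ℝ A
  refine Units.ext ?_
  rw [Units.val_mul, val_oneParam, val_oneParam, val_oneParam, ← exp_add_of_commute, add_smul]
  exact ((Commute.refl Y).smul_left _).smul_right _

theorem oneParam_nsmul (Y : A) (n : ℕ) (t : ℝ) : oneParam Y (n * t) = oneParam Y t ^ n := by
  induction n with
  | zero => rw [Nat.cast_zero, zero_mul, oneParam_zero, pow_zero]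
  | succ n ih => rw [Nat.cast_succ, add_mul, one_mul, oneParam_add, ih, pow_succ]

theorem oneParam_conj (u : Aˣ) (Y : A) (t : ℝ) :
    oneParam ((u : A) * Y * (u⁻¹ : Aˣ)) t = u * oneParam Y t * u⁻¹ := by
  let _ : NormedAlgebra ℚ A := .restrictScalars ℚ ℝ A
  refine Units.ext ?_
  rw [Units.val_mul, Units.val_mul, val_oneParam, val_oneParam, ← exp_units_conj,
    mul_smul_comm, smul_mul_assoc]

theorem hasDerivAt_oneParam (Y : A) (t : ℝ) :
    HasDerivAt (fun t => (oneParam Y t : A)) ((oneParam Y t : A) * Y) t :=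
  hasDerivAt_exp_smul_const Y t

theorem continuous_val_oneParam (Y : A) : Continuous fun t => (oneParam Y t : A) :=
  continuous_iff_continuousAt.2 fun t => (hasDerivAt_oneParam Y t).continuousAt

theorem tendsto_oneParam_slope (Y : A) {s : ℕ → ℝ} (hs : ∀ k, 0 < s k)
    (hs0 : Tendsto s atTop (𝓝 0)) :
    Tendsto (fun k => (s k)⁻¹ • ((oneParam Y (s k) : A) - 1)) atTop (𝓝 Y) := by
  have h := (hasDerivAt_oneParam Y 0).tendsto_slope_zero
  simp only [oneParam_zero, zero_add, Units.val_one, one_mul] at h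
  exact h.comp (tendsto_nhdsWithin_iff.2 ⟨hs0, Eventually.of_forall fun k => (hs k).ne'⟩)

/-- With a local logarithm, `log (h k) / s k` tends to `Y`, hence `h k ^ ⌊t / s k⌋ = exp (⌊t / s k⌋
• log (h k))` tends to `exp (t • Y)`. These powers lie in the closed group `G`. -/
theorem exp_mem_of_tendsto_slope_of_nonneg {G : Subgroup Aˣ} (hG : IsClosed (G : Set Aˣ))
    {h : ℕ → Aˣ} (hh : ∀ k, h k ∈ G) {s : ℕ → ℝ} (hs : ∀ k, 0 < s k)
    (hs0 : Tendsto s atTop (𝓝 0)) {Y : A}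
    (hY : Tendsto (fun k => (s k)⁻¹ • ((h k : A) - 1)) atTop (𝓝 Y)) {t : ℝ} (ht : 0 ≤ t) :
    oneParam Y t ∈ G := by
  let _ : NormedAlgebra ℚ A := .restrictScalars ℚ ℝ A
  have hd : HasStrictFDerivAt (exp : A → A)
      ((ContinuousLinearEquiv.refl ℝ A : A ≃L[ℝ] A) : A →L[ℝ] A) 0 :=
    hasStrictFDerivAt_exp_zero
  -- The local logarithm near 1.
  set g := hd.localInverse with hg
  have hg0 : g 1 = 0 := by
    have := hd.localInverse_apply_image
    rwa [exp_zero] at this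
  have hgd : HasFDerivAt g (1 : A →L[ℝ] A) 1 := by
    have := hd.to_localInverse.hasFDerivAt
    rwa [exp_zero] at this
  have hright : ∀ᶠ y in 𝓝 (1 : A), exp (g y) = y := by
    have := hd.eventually_right_inverse
    rwa [exp_zero] at this
  have hh1 : Tendsto (fun k => (h k : A) - 1) atTop (𝓝 0) := by
    have := hs0.smul hY
    rw [zero_smul] at this
    refine this.congr fun k => ?_
    rw [smul_smul, mul_inv_cancel₀ (hs k).ne', one_smul]
  have hh1' : Tendsto (fun k => (h k : A)) atTop (𝓝 1) := by
    simpa using hh1.add_const 1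
  have hZ : Tendsto (fun k => (s k)⁻¹ • g (h k)) atTop (𝓝 Y) := by
    have := (hasFDerivWithinAt_univ.2 hgd).lim hh1 (by simp) hY
    simpa [hg0] using this
  have hn : Tendsto (fun k => (⌊t * (s k)⁻¹⌋₊ : ℝ) * s k) atTop (𝓝 t) := by
    have hinv : Tendsto (fun k => (s k)⁻¹) atTop atTop :=
      tendsto_inv_nhdsGT_zero.comp
        (tendsto_nhdsWithin_iff.2 ⟨hs0, Eventually.of_forall fun k => hs k⟩)
    have := (tendsto_nat_floor_mul_div_atTop ht).comp hinv
    refine this.congr fun k => ?_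
    simp
  have hlim : Tendsto (fun k => ((h k ^ ⌊t * (s k)⁻¹⌋₊ : Aˣ) : A)) atTop
      (𝓝 (oneParam Y t : A)) := by
    have h1 : Tendsto (fun k => exp (((⌊t * (s k)⁻¹⌋₊ : ℝ) * s k) • ((s k)⁻¹ • g (h k))))
        atTop (𝓝 (exp (t • Y))) := (exp_continuous.tendsto _).comp (hn.smul hZ)
    refine h1.congr' ?_
    filter_upwards [hh1'.eventually hright] with k hk
    rw [smul_smul, mul_assoc, mul_inv_cancel₀ (hs k).ne', mul_one, Nat.cast_smul_eq_nsmul,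
      exp_nsmul, hk, Units.val_pow_eq_pow_val]
  exact hG.mem_of_tendsto (Units.isOpenEmbedding_val.isEmbedding.tendsto_nhds_iff.2 hlim)
    (Eventually.of_forall fun k => G.pow_mem (hh k) _)

theorem exp_mem_of_tendsto_slope {G : Subgroup Aˣ} (hG : IsClosed (G : Set Aˣ))
    {h : ℕ → Aˣ} (hh : ∀ k, h k ∈ G) {s : ℕ → ℝ} (hs : ∀ k, 0 < s k)
    (hs0 : Tendsto s atTop (𝓝 0)) {Y : A}
    (hY : Tendsto (fun k => (s k)⁻¹ • ((h k : A) - 1)) atTop (𝓝 Y)) (t : ℝ) :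
    oneParam Y t ∈ G := by
  rcases le_total 0 t with ht | ht
  · exact exp_mem_of_tendsto_slope_of_nonneg hG hh hs hs0 hY ht
  · rw [← inv_inv (oneParam Y t), oneParam_inv]
    exact G.inv_mem
      (exp_mem_of_tendsto_slope_of_nonneg hG hh hs hs0 hY (neg_nonneg.2 ht))

/-- The Lie algebra of a closed subgroup, as a real vector space. -/
def tangentSpace (G : Subgroup Aˣ) (hG : IsClosed (G : Set Aˣ)) : Submodule ℝ A where
  carrier := {Y | ∀ t : ℝ, oneParam Y t ∈ G}
  zero_mem' t := by
    have : oneParam (0 : A) t = 1 := Units.ext (by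
      rw [val_oneParam, smul_zero, exp_zero, Units.val_one])
    rw [this]
    exact G.one_mem
  smul_mem' c Y hY t := by
    rw [oneParam_smul]
    exact hY _
  add_mem' {X Y} hX hY := by
    have hs : ∀ k : ℕ, 0 < 1 / ((k : ℝ) + 1) := fun k => by positivity
    -- The curve `exp (s X) * exp (s Y)` stays in `G` and has slope `X + Y` at 0.
    refine exp_mem_of_tendsto_slope hG
      (h := fun k : ℕ => oneParam X (1 / ((k : ℝ) + 1)) * oneParam Y (1 / ((k : ℝ) + 1)))
      (fun k => G.mul_mem (hX _) (hY _)) hs tendsto_one_div_add_atTop_nhds_zero_nat ?_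
    have h1 := tendsto_oneParam_slope X hs tendsto_one_div_add_atTop_nhds_zero_nat
    have h2 := tendsto_oneParam_slope Y hs tendsto_one_div_add_atTop_nhds_zero_nat
    have h3 : Tendsto (fun k : ℕ => (oneParam Y (1 / ((k : ℝ) + 1)) : A)) atTop (𝓝 1) := by
      have := ((continuous_val_oneParam Y).tendsto 0).comp
        (tendsto_one_div_add_atTop_nhds_zero_nat (𝕜 := ℝ))
      rwa [oneParam_zero, Units.val_one] at this
    have h4 := (h1.mul h3).add h2
    rw [mul_one] at h4
    refine h4.congr fun k => ?_
    rw [Units.val_mul, smul_mul_assoc, ← smul_add]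
    congr 1
    noncomm_ring

theorem conj_mem_tangentSpace {G : Subgroup Aˣ} {hG : IsClosed (G : Set Aˣ)} {u : Aˣ}
    (hu : u ∈ G) {Y : A} (hY : Y ∈ tangentSpace G hG) :
    (u : A) * Y * (u⁻¹ : Aˣ) ∈ tangentSpace G hG := fun t => by
  rw [oneParam_conj]
  exact G.mul_mem (G.mul_mem hu (hY t)) (G.inv_mem hu)

/-- The closed subgroup generated by the one-parameter subgroups of `G`. -/
def connectedPart (G : Subgroup Aˣ) : Subgroup Aˣ :=
  (Subgroup.closure {u | ∃ Y : A, (∀ t, oneParam Y t ∈ G) ∧ ∃ t, u = oneParam Y t}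
    ).topologicalClosure

theorem isClosed_connectedPart (G : Subgroup Aˣ) : IsClosed (connectedPart G : Set Aˣ) :=
  Subgroup.isClosed_topologicalClosure _

theorem oneParam_mem_connectedPart {G : Subgroup Aˣ} {Y : A} (hY : ∀ t, oneParam Y t ∈ G)
    (t : ℝ) : oneParam Y t ∈ connectedPart G :=
  Subgroup.le_topologicalClosure _ (Subgroup.subset_closure ⟨Y, hY, t, rfl⟩)

theorem connectedPart_le {G : Subgroup Aˣ} (hG : IsClosed (G : Set Aˣ)) :
    connectedPart G ≤ G := by
  refine Subgroup.topologicalClosure_minimal _ ((Subgroup.closure_le _).2 ?_) hG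
  rintro _ ⟨Y, hY, t, rfl⟩
  exact hY t

theorem conj_mem_connectedPart {G : Subgroup Aˣ} {u : Aˣ} (hu : u ∈ G) {c : Aˣ}
    (hc : c ∈ connectedPart G) : u * c * u⁻¹ ∈ connectedPart G := by
  have key : connectedPart G ≤ (connectedPart G).comap (MulAut.conj u).toMonoidHom := by
    refine Subgroup.topologicalClosure_minimal _ ((Subgroup.closure_le _).2 ?_) ?_
    · rintro _ ⟨Y, hY, t, rfl⟩
      change u * oneParam Y t * u⁻¹ ∈ connectedPart G
      rw [← oneParam_conj]
      refine oneParam_mem_connectedPart (fun s => ?_) t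
      rw [oneParam_conj]
      exact G.mul_mem (G.mul_mem hu (hY s)) (G.inv_mem hu)
    · refine (isClosed_connectedPart G).preimage ?_
      change Continuous fun x => u * x * u⁻¹
      fun_prop
  exact key hc

omit [NormedAlgebra ℝ A] in
-- As `C` is closed and misses `u`, the coset `u C` keeps a positive distance from 1. A
-- representative within a factor 2 of that distance suffices, so no minimum needs to be attained.
theorem exists_near_minimizer {C : Subgroup Aˣ} (hC : IsClosed (C : Set Aˣ)) {u : Aˣ}
    (hu : u ∉ C) : ∃ c ∈ C, 0 < ‖((u * c : Aˣ) : A) - 1‖ ∧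
      ‖((u * c : Aˣ) : A) - 1‖ ≤ 2 * ‖(u : A) - 1‖ ∧
      ∀ c' ∈ C, ‖((u * c : Aˣ) : A) - 1‖ ≤ 2 * ‖((u * c * c' : Aˣ) : A) - 1‖ := by
  let S : Set ℝ := (fun c : Aˣ => ‖((u * c : Aˣ) : A) - 1‖) '' C
  have hSne : S.Nonempty := ⟨_, 1, C.one_mem, rfl⟩
  have hSbdd : BddBelow S := ⟨0, by rintro _ ⟨c, -, rfl⟩; exact norm_nonneg _⟩
  have hle : ∀ c ∈ C, sInf S ≤ ‖((u * c : Aˣ) : A) - 1‖ := fun c hc =>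
    csInf_le hSbdd ⟨c, hc, rfl⟩
  have hpos : 0 < sInf S := by
    by_contra hneg
    have hex : ∀ k : ℕ, ∃ c ∈ C, ‖((u * c : Aˣ) : A) - 1‖ < 1 / ((k : ℝ) + 1) := by
      intro k
      have : sInf S < 1 / ((k : ℝ) + 1) := lt_of_le_of_lt (not_lt.1 hneg) (by positivity)
      obtain ⟨_, ⟨c, hc, rfl⟩, h⟩ := exists_lt_of_csInf_lt hSne this
      exact ⟨c, hc, h⟩
    choose c hc hlt using hex
    have h1 : Tendsto (fun k => ((u * c k : Aˣ) : A)) atTop (𝓝 ((1 : Aˣ) : A)) := by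
      rw [tendsto_iff_norm_sub_tendsto_zero]
      exact squeeze_zero (fun _ => norm_nonneg _) (fun k => (hlt k).le)
        tendsto_one_div_add_atTop_nhds_zero_nat
    have h2 : Tendsto (fun k => u * c k) atTop (𝓝 1) :=
      Units.isOpenEmbedding_val.isEmbedding.tendsto_nhds_iff.2 h1
    have h3 : Tendsto c atTop (𝓝 u⁻¹) := by
      have := h2.const_mul u⁻¹
      simpa using this
    exact hu (inv_mem_iff.1 (hC.mem_of_tendsto h3 (Eventually.of_forall hc)))
  obtain ⟨_, ⟨c, hc, rfl⟩, h⟩ := exists_lt_of_csInf_lt hSne (by linarith : sInf S < 2 * sInf S)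
  refine ⟨c, hc, hpos.trans_le (hle c hc), ?_, fun c' hc' => ?_⟩
  · have := hle 1 C.one_mem
    rw [mul_one] at this
    dsimp only at h
    linarith
  · have := hle (c * c') (C.mul_mem hc hc')
    rw [← mul_assoc] at this
    dsimp only at h
    linarith

/-- Otherwise take elements of `G` outside `connectedPart G` tending to 1, and replace them by
near-minimal coset representatives `h k` at distance `s k` from 1. A limit direction `Y` of `(h k -
1) / s k` is tangent to `G`, so `exp (-s k • Y)` lies in `connectedPart G`. Multiplying by it brings
`h k` within `o(s k)` of 1, against near-minimality. -/
theorem exists_forall_norm_lt_mem_connectedPart [FiniteDimensional ℝ A] {G : Subgroup Aˣ}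
    (hG : IsClosed (G : Set Aˣ)) :
    ∃ δ > 0, ∀ u ∈ G, ‖(u : A) - 1‖ < δ → u ∈ connectedPart G := by
  by_contra! hcon
  have hC := isClosed_connectedPart G
  have hCG := connectedPart_le hG
  choose u huG hu huC using fun k : ℕ => hcon (1 / ((k : ℝ) + 1)) (by positivity)
  choose c hcC hpos hle hmin using fun k => exists_near_minimizer hC (huC k)
  set h : ℕ → Aˣ := fun k => u k * c k with hh
  set s : ℕ → ℝ := fun k => ‖(h k : A) - 1‖ with hs
  have hhG : ∀ k, h k ∈ G := fun k => G.mul_mem (huG k) (hCG (hcC k))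
  have hs0 : Tendsto s atTop (𝓝 0) := by
    refine squeeze_zero (fun _ => norm_nonneg _)
      (fun k => (hle k).trans (mul_le_mul_of_nonneg_left (hu k).le zero_le_two)) ?_
    simpa using (tendsto_one_div_add_atTop_nhds_zero_nat (𝕜 := ℝ)).const_mul 2
  have hball : ∀ k, (s k)⁻¹ • ((h k : A) - 1) ∈ Metric.closedBall (0 : A) 1 := fun k => by
    rw [mem_closedBall_zero_iff, norm_smul, norm_inv, Real.norm_of_nonneg (hpos k).le]
    exact (inv_mul_cancel₀ (hpos k).ne').le
  have : ProperSpace A := FiniteDimensional.proper ℝ A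
  obtain ⟨Y, -, φ, hφ, hY⟩ := (isCompact_closedBall (0 : A) 1).tendsto_subseq hball
  have hYG : ∀ t, oneParam Y t ∈ G := exp_mem_of_tendsto_slope hG (h := h ∘ φ)
    (fun k => hhG _) (s := s ∘ φ) (fun k => hpos _) (hs0.comp hφ.tendsto_atTop) hY
  have hYC := oneParam_mem_connectedPart hYG
  have hs0' := hs0.comp hφ.tendsto_atTop
  have h1 := tendsto_oneParam_slope (-Y) (s := s ∘ φ) (fun k => hpos _) hs0'
  have h2 : Tendsto (fun k => (oneParam (-Y) ((s ∘ φ) k) : A)) atTop (𝓝 1) := by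
    have := ((continuous_val_oneParam (-Y)).tendsto 0).comp hs0'
    rwa [oneParam_zero, Units.val_one] at this
  have h3 := ((hY.mul h2).add h1).norm
  rw [mul_one, add_neg_cancel, norm_zero] at h3
  -- The factor 2 of near-minimality becomes the lower bound 1/2 after division by `s k`.
  have h4 : ∀ k, (1 / 2 : ℝ) ≤ ‖((fun k => (s k)⁻¹ • ((h k : A) - 1)) ∘ φ) k *
      (oneParam (-Y) ((s ∘ φ) k) : A) +
      ((s ∘ φ) k)⁻¹ • ((oneParam (-Y) ((s ∘ φ) k) : A) - 1)‖ := by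
    intro k
    have e : ((fun k => (s k)⁻¹ • ((h k : A) - 1)) ∘ φ) k * (oneParam (-Y) ((s ∘ φ) k) : A) +
        ((s ∘ φ) k)⁻¹ • ((oneParam (-Y) ((s ∘ φ) k) : A) - 1) =
        (s (φ k))⁻¹ • (((h (φ k) * oneParam (-Y) (s (φ k)) : Aˣ) : A) - 1) := by
      simp only [Function.comp_apply]
      rw [Units.val_mul (h (φ k)), smul_mul_assoc, ← smul_add, sub_mul, one_mul,
        sub_add_sub_cancel]
    rw [e, norm_smul, norm_inv, Real.norm_of_nonneg (hpos (φ k)).le]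
    have hmem : oneParam (-Y) (s (φ k)) ∈ connectedPart G := by
      have e2 : oneParam (-Y) (s (φ k)) = oneParam Y (-s (φ k)) :=
        Units.ext (by rw [val_oneParam, val_oneParam, smul_neg, neg_smul])
      rw [e2]
      exact hYC _
    have h5 := hmin (φ k) _ hmem
    have h6 : s (φ k) ≤ 2 * ‖((h (φ k) * oneParam (-Y) (s (φ k)) : Aˣ) : A) - 1‖ := h5
    rw [le_inv_mul_iff₀ (hpos (φ k))]
    change s (φ k) * (1 / 2) ≤ _
    linarith
  have := ge_of_tendsto' h3 h4
  norm_num at this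

end OneParameter

/-! ### Complete reducibility and averaging of projections -/

/-- The units commuting with a given element of a ring. -/
def commutingUnits {A : Type*} [Ring A] (p : A) : Subgroup Aˣ where
  carrier := {u | (u : A) * p = p * u}
  one_mem' := by simp
  mul_mem' {a b} ha hb := by
    change ((a * b : Aˣ) : A) * p = p * (a * b : Aˣ)
    rw [Units.val_mul, mul_assoc, show (b : A) * p = p * b from hb, ← mul_assoc,
      show (a : A) * p = p * a from ha, mul_assoc]
  inv_mem' {a} ha := by
    change ((a⁻¹ : Aˣ) : A) * p = p * (a⁻¹ : Aˣ)
    rw [Units.inv_mul_eq_iff_eq_mul, ← mul_assoc, show (a : A) * p = p * a from ha, mul_assoc,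
      Units.mul_inv, mul_one]

theorem mem_commutingUnits {A : Type*} [Ring A] {p : A} {u : Aˣ} :
    u ∈ commutingUnits p ↔ (u : A) * p = p * u := Iff.rfl

section CompletelyReducible

variable {V : Type*} [NormedAddCommGroup V] [NormedSpace ℂ V]

/-- A subspace is invariant under a group of invertible operators. -/
def IsInvariantUnder (H : Subgroup (V →L[ℂ] V)ˣ) (W : Submodule ℂ V) : Prop :=
  ∀ h ∈ H, ∀ w ∈ W, (h : V →L[ℂ] V) w ∈ W

theorem IsInvariantUnder.mono {H K : Subgroup (V →L[ℂ] V)ˣ} (hHK : H ≤ K) {W : Submodule ℂ V}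
    (hW : IsInvariantUnder K W) : IsInvariantUnder H W := fun h hh => hW h (hHK hh)

/-- `p` is a projection onto `W`. -/
def IsProjectionOnto (p : V →L[ℂ] V) (W : Submodule ℂ V) : Prop :=
  (∀ v, p v ∈ W) ∧ ∀ w ∈ W, p w = w

/-- Every invariant subspace is the range of an equivariant projection. -/
def CompletelyReducible (H : Subgroup (V →L[ℂ] V)ˣ) : Prop :=
  ∀ W : Submodule ℂ V, IsInvariantUnder H W →
    ∃ p : V →L[ℂ] V, IsProjectionOnto p W ∧ H ≤ commutingUnits p

theorem IsProjectionOnto.conj {p : V →L[ℂ] V} {W : Submodule ℂ V} (hp : IsProjectionOnto p W)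
    {H : Subgroup (V →L[ℂ] V)ˣ} (hW : IsInvariantUnder H W) {u : (V →L[ℂ] V)ˣ} (hu : u ∈ H) :
    IsProjectionOnto ((u : V →L[ℂ] V) * p * ((u⁻¹ : (V →L[ℂ] V)ˣ) : V →L[ℂ] V)) W := by
  refine ⟨fun v => hW u hu _ (hp.1 _), fun w hw => ?_⟩
  change (u : V →L[ℂ] V) (p (((u⁻¹ : (V →L[ℂ] V)ˣ) : V →L[ℂ] V) w)) = w
  rw [hp.2 _ (hW _ (H.inv_mem hu) w hw)]
  change ((u : V →L[ℂ] V) * ((u⁻¹ : (V →L[ℂ] V)ˣ) : V →L[ℂ] V)) w = w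
  simp

theorem IsProjectionOnto.average {ι : Type*} (s : Finset ι) (hs : s.Nonempty)
    {p : ι → V →L[ℂ] V} {W : Submodule ℂ V} (hp : ∀ i ∈ s, IsProjectionOnto (p i) W) :
    IsProjectionOnto ((s.card : ℂ)⁻¹ • ∑ i ∈ s, p i) W := by
  have hne : (s.card : ℂ) ≠ 0 := Nat.cast_ne_zero.2 hs.card_pos.ne'
  refine ⟨fun v => ?_, fun w hw => ?_⟩
  · rw [smul_apply, sum_apply]
    exact W.smul_mem _ (W.sum_mem fun i hi => (hp i hi).1 v)
  · rw [smul_apply, sum_apply,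
      Finset.sum_congr rfl fun i hi => (hp i hi).2 w hw, Finset.sum_const,
      ← Nat.cast_smul_eq_nsmul ℂ, smul_smul, inv_mul_cancel₀ hne, one_smul]

/-- Commuting with a fixed projection is a linear condition, so it passes from `M` to its span. -/
theorem CompletelyReducible.of_subset_span {M N : Subgroup (V →L[ℂ] V)ˣ}
    (hM : CompletelyReducible M) (hMN : M ≤ N)
    (hspan : ∀ n ∈ N, (n : V →L[ℂ] V) ∈
      Submodule.span ℂ ((fun u : (V →L[ℂ] V)ˣ => (u : V →L[ℂ] V)) '' M)) :
    CompletelyReducible N := by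
  intro W hW
  obtain ⟨p, hp, hc⟩ := hM W (hW.mono hMN)
  refine ⟨p, hp, fun n hn => ?_⟩
  rw [mem_commutingUnits]
  have h := hspan n hn
  generalize (n : V →L[ℂ] V) = a at h
  induction h using Submodule.span_induction with
  | mem x hx =>
    obtain ⟨m, hm, rfl⟩ := hx
    exact hc hm
  | zero => simp
  | add x y _ _ hx hy => rw [add_mul, mul_add, hx, hy]
  | smul c x _ hx => rw [smul_mul_assoc, mul_smul_comm, hx]

theorem CompletelyReducible.topologicalClosure {H : Subgroup (V →L[ℂ] V)ˣ}
    (h : CompletelyReducible H) : CompletelyReducible H.topologicalClosure := by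
  intro W hW
  obtain ⟨p, hp, hc⟩ := h W (hW.mono (Subgroup.le_topologicalClosure H))
  refine ⟨p, hp, Subgroup.topologicalClosure_minimal _ hc ?_⟩
  exact isClosed_eq (Units.continuous_val.mul continuous_const)
    (continuous_const.mul Units.continuous_val)

/-- Average the conjugates of an `M`-equivariant projection by `x ^ i`, `i < n`. Each still commutes
with `M` because conjugation by `x⁻¹` preserves `M`; conjugation by `x` shifts them cyclically
because `x ^ n` commutes with `p`. -/
theorem CompletelyReducible.sup_zpowers {M : Subgroup (V →L[ℂ] V)ˣ} (hM : CompletelyReducible M)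
    {x : (V →L[ℂ] V)ˣ} (hx : ∀ m ∈ M, x⁻¹ * m * x ∈ M) {n : ℕ} (hn : 0 < n) (hxn : x ^ n ∈ M) :
    CompletelyReducible (M ⊔ Subgroup.zpowers x) := by
  intro W hW
  obtain ⟨p, hp, hc⟩ := hM W (hW.mono le_sup_left)
  have hxmem : x ∈ M ⊔ Subgroup.zpowers x :=
    (le_sup_right : _ ≤ M ⊔ Subgroup.zpowers x) (Subgroup.mem_zpowers x)
  let f : ℕ → V →L[ℂ] V := fun i => ((x ^ i : (V →L[ℂ] V)ˣ) : V →L[ℂ] V) * p *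
    ((x ^ i)⁻¹ : (V →L[ℂ] V)ˣ)
  refine ⟨_, IsProjectionOnto.average (Finset.range n) ⟨0, Finset.mem_range.2 hn⟩ (p := f)
    fun i _ => hp.conj hW (Subgroup.pow_mem _ hxmem i), sup_le (fun m hm => ?_) ?_⟩
  · have hxi : ∀ i : ℕ, (x ^ i)⁻¹ * m * x ^ i ∈ M := by
      intro i
      induction i with
      | zero => simpa using hm
      | succ i ih =>
        have := hx _ ih
        rw [pow_succ]
        simpa [mul_assoc] using this
    have hfi : ∀ i, (m : V →L[ℂ] V) * f i = f i * m := by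
      intro i
      have h1 : (((x ^ i)⁻¹ * m * x ^ i : (V →L[ℂ] V)ˣ) : V →L[ℂ] V) * p = p *
        ((x ^ i)⁻¹ * m * x ^ i : (V →L[ℂ] V)ˣ) := hc (hxi i)
      have h2 : m * x ^ i = x ^ i * ((x ^ i)⁻¹ * m * x ^ i) := by group
      have h3 : ((x ^ i)⁻¹ * m * x ^ i) * (x ^ i)⁻¹ = (x ^ i)⁻¹ * m := by group
      calc (m : V →L[ℂ] V) * f i
          = ((m * x ^ i : (V →L[ℂ] V)ˣ) : V →L[ℂ] V) * p * ((x ^ i)⁻¹ : (V →L[ℂ] V)ˣ) := by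
            simp only [f, Units.val_mul, mul_assoc]
        _ = ((x ^ i : (V →L[ℂ] V)ˣ) : V →L[ℂ] V) *
            ((((x ^ i)⁻¹ * m * x ^ i : (V →L[ℂ] V)ˣ) : V →L[ℂ] V) * p) *
            ((x ^ i)⁻¹ : (V →L[ℂ] V)ˣ) := by
            rw [h2]; simp only [Units.val_mul, mul_assoc]
        _ = ((x ^ i : (V →L[ℂ] V)ˣ) : V →L[ℂ] V) * p *
            (((x ^ i)⁻¹ * m * x ^ i * (x ^ i)⁻¹ : (V →L[ℂ] V)ˣ) : V →L[ℂ] V) := by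
            rw [h1, Units.val_mul _ (x ^ i)⁻¹]; simp only [mul_assoc]
        _ = f i * m := by
            rw [h3]; simp only [f, Units.val_mul, mul_assoc]
    rw [mem_commutingUnits, mul_smul_comm, smul_mul_assoc, Finset.mul_sum, Finset.sum_mul]
    exact congrArg _ (Finset.sum_congr rfl fun i _ => hfi i)
  · rw [Subgroup.zpowers_le, mem_commutingUnits, mul_smul_comm, smul_mul_assoc, Finset.mul_sum,
      Finset.sum_mul]
    congr 1
    have hstep : ∀ i, (x : V →L[ℂ] V) * f i = f (i + 1) * x := by
      intro i
      simp only [f]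
      rw [pow_succ', mul_inv_rev, Units.val_mul, Units.val_mul]
      simp only [mul_assoc, Units.inv_mul, mul_one]
    have hfn : f n = f 0 := by
      have h1 : ((x ^ n : (V →L[ℂ] V)ˣ) : V →L[ℂ] V) * p = p * (x ^ n : (V →L[ℂ] V)ˣ) := hc hxn
      simp only [f]
      rw [h1, mul_assoc, Units.mul_inv]
      simp
    rw [Finset.sum_congr rfl fun i _ => hstep i]
    rw [← Finset.sum_mul, ← Finset.sum_mul]
    congr 1
    have h1 := Finset.sum_range_succ f n
    have h2 := Finset.sum_range_succ' f n
    rw [h1, hfn] at h2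
    exact (add_right_cancel h2).symm

/-- Maschke averaging over left cosets: the conjugate of `p` by `g` depends only on `g H`, since `p`
commutes with `H`. Normality is not needed. -/
theorem CompletelyReducible.of_finite_quotient {H G : Subgroup (V →L[ℂ] V)ˣ}
    (hH : CompletelyReducible H) (hHG : H ≤ G) [Finite (G ⧸ H.subgroupOf G)] :
    CompletelyReducible G := by
  intro W hW
  obtain ⟨p, hp, hc⟩ := hH W (hW.mono hHG)
  have := Fintype.ofFinite (G ⧸ H.subgroupOf G)
  let c : G → V →L[ℂ] V := fun g => ((g : (V →L[ℂ] V)ˣ) : V →L[ℂ] V) * p *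
    ((g : (V →L[ℂ] V)ˣ)⁻¹ : (V →L[ℂ] V)ˣ)
  let f : G ⧸ H.subgroupOf G → V →L[ℂ] V := Quotient.lift c fun a b hab => by
    have h1 : a⁻¹ * b ∈ H.subgroupOf G := QuotientGroup.leftRel_apply.1 hab
    have h2 : (a : (V →L[ℂ] V)ˣ)⁻¹ * b ∈ H := h1
    have h3 := mem_commutingUnits.1 (hc h2)
    obtain ⟨k, hk⟩ : ∃ k, k = (a : (V →L[ℂ] V)ˣ)⁻¹ * b := ⟨_, rfl⟩
    have hb : (b : (V →L[ℂ] V)ˣ) = a * k := by rw [hk]; group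
    rw [← hk] at h3
    simp only [c]
    rw [hb, mul_inv_rev, Units.val_mul, Units.val_mul, mul_assoc _ (k : V →L[ℂ] V), h3]
    simp only [mul_assoc, Units.mul_inv_cancel_left]
  have hf : ∀ g : G, f (g : G ⧸ H.subgroupOf G) = c g := fun g => rfl
  have hfs : ∀ (g : G) (q : G ⧸ H.subgroupOf G),
      ((g : (V →L[ℂ] V)ˣ) : V →L[ℂ] V) * f q = f (g • q) * (g : (V →L[ℂ] V)ˣ) := by
    intro g q
    induction q using QuotientGroup.induction_on with
    | H a =>
      rw [MulAction.Quotient.smul_coe, hf, hf, smul_eq_mul]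
      simp only [c]
      rw [Subgroup.coe_mul, mul_inv_rev, Units.val_mul, Units.val_mul]
      simp only [mul_assoc, Units.inv_mul, mul_one]
  refine ⟨_, IsProjectionOnto.average Finset.univ Finset.univ_nonempty (p := f) fun q _ => ?_,
    fun g hg => ?_⟩
  · induction q using QuotientGroup.induction_on with
    | H a => exact hp.conj hW a.2
  · rw [mem_commutingUnits, mul_smul_comm, smul_mul_assoc, Finset.mul_sum, Finset.sum_mul]
    congr 1
    calc ∑ q, (g : V →L[ℂ] V) * f q = ∑ q, f ((⟨g, hg⟩ : G) • q) * g :=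
          Finset.sum_congr rfl fun q _ => hfs ⟨g, hg⟩ q
      _ = ∑ q, f q * g :=
          Equiv.sum_comp (MulAction.toPerm (⟨g, hg⟩ : G)) fun q => f q * (g : V →L[ℂ] V)

end CompletelyReducible

/-! ### Bounded flows have semisimple generators with imaginary spectrum -/

section Flow

open Filter Topology

/-- An eigenvector evolves as `exp (c t) • v`, bounded for all real `t` only if `c` is imaginary. If
`T (T v) = 0`, then `v` evolves as `v + t • T v`, bounded only if `T v = 0`. -/
theorem ImaginarySemisimple.of_bounded_flow {E : Type*} [NormedAddCommGroup E] [NormedSpace ℂ E]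
    (T : Module.End ℂ E) (Φ : ℝ → E →ₗ[ℂ] E) (hΦ0 : Φ 0 = LinearMap.id)
    (hderiv : ∀ v t, HasDerivAt (fun t => Φ t v) (Φ t (T v)) t)
    (hbdd : ∀ v, ∃ M, ∀ t, ‖Φ t v‖ ≤ M) : ImaginarySemisimple T where
  re_eq_zero c v hv h := by
    have hconst : ∀ t : ℝ, Complex.exp (-(c * t)) • Φ t v = v := by
      have hd : ∀ t : ℝ, HasDerivAt (fun t : ℝ => Complex.exp (-(c * t)) • Φ t v) 0 t := by
        intro t
        have h1 : HasDerivAt (fun t : ℝ => Complex.exp (-(c * t)))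
            (Complex.exp (-(c * t)) * -(c * 1)) t :=
          (((hasDerivAt_id (t : ℂ)).const_mul c).neg.cexp).comp_ofReal
        have h2 := h1.smul (hderiv v t)
        rw [h, map_smul] at h2
        refine h2.congr_deriv ?_
        rw [smul_smul, ← add_smul]
        simp
      intro t
      have := is_const_of_deriv_eq_zero (fun t => (hd t).differentiableAt)
        (fun t => (hd t).deriv) t 0
      simpa [hΦ0] using this
    obtain ⟨M, hM⟩ := hbdd v
    have hnorm : ∀ t : ℝ, Real.exp (c.re * t) * ‖v‖ ≤ M := by
      intro t
      have h1 : Φ t v = Complex.exp (c * t) • v := by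
        conv_rhs => rw [← hconst t]
        rw [smul_smul, ← Complex.exp_add, add_neg_cancel, Complex.exp_zero, one_smul]
      have h2 := hM t
      rw [h1, norm_smul, Complex.norm_exp] at h2
      simpa using h2
    by_contra hne
    have hvpos : 0 < ‖v‖ := norm_pos_iff.2 hv
    -- At this time the growth factor is `exp (M / ‖v‖) ≥ M / ‖v‖ + 1`, which overshoots `M`.
    have h1 := hnorm ((M / ‖v‖) / c.re)
    rw [mul_div_cancel₀ _ hne] at h1
    have h2 := Real.add_one_le_exp (M / ‖v‖)
    have h3 : (M / ‖v‖ + 1) * ‖v‖ ≤ M := (mul_le_mul_of_nonneg_right h2 hvpos.le).trans h1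
    rw [add_mul, div_mul_cancel₀ _ hvpos.ne'] at h3
    linarith
  ker_sq v h := by
    have h1 : ∀ t, Φ t (T v) = T v := by
      intro t
      have hd : ∀ t, HasDerivAt (fun t => Φ t (T v)) 0 t := fun t => by
        have := hderiv (T v) t
        rwa [h, map_zero] at this
      have := is_const_of_deriv_eq_zero (fun t => (hd t).differentiableAt)
        (fun t => (hd t).deriv) t 0
      simpa [hΦ0] using this
    have h2 : ∀ t, Φ t v = v + t • T v := by
      intro t
      have hd : ∀ t, HasDerivAt (fun t : ℝ => Φ t v - t • T v) 0 t := fun t => by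
        have h3 := hderiv v t
        rw [h1] at h3
        refine (h3.sub ((hasDerivAt_id t).smul_const (T v))).congr_deriv ?_
        rw [one_smul, sub_self]
      have := is_const_of_deriv_eq_zero (fun t => (hd t).differentiableAt)
        (fun t => (hd t).deriv) t 0
      simp only [hΦ0, LinearMap.id_apply, zero_smul, sub_zero] at this
      exact sub_eq_iff_eq_add.1 this
    by_contra hne
    have hpos : 0 < ‖T v‖ := norm_pos_iff.2 hne
    obtain ⟨M, hM⟩ := hbdd v
    have h3 := hM ((M + ‖v‖ + 1) / ‖T v‖)
    have hM0 : 0 ≤ M := (norm_nonneg _).trans (hM 0)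
    have hc : 0 ≤ (M + ‖v‖ + 1) / ‖T v‖ := by positivity
    rw [h2] at h3
    have h4 : ‖((M + ‖v‖ + 1) / ‖T v‖) • T v‖ = M + ‖v‖ + 1 := by
      rw [norm_smul, Real.norm_of_nonneg hc, div_mul_cancel₀ _ hpos.ne']
    have h5 := norm_sub_le (v + ((M + ‖v‖ + 1) / ‖T v‖) • T v) v
    rw [add_sub_cancel_left, h4] at h5
    linarith

/-- All powers of `a` are bounded. -/
def PowerBounded {A : Type*} [NormedRing A] (a : A) : Prop := ∃ M, ∀ m : ℕ, ‖a ^ m‖ ≤ M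

/-- Integer times are powers of the elements at times 1 and -1; the fractional remainder ranges over
a compact interval. -/
theorem exists_forall_norm_oneParam_le {A : Type*} [NormedRing A] [NormedAlgebra ℝ A]
    [CompleteSpace A] {Y : A} (hY : ∀ t, PowerBounded (oneParam Y t : A)) :
    ∃ M, ∀ t, ‖(oneParam Y t : A)‖ ≤ M := by
  obtain ⟨K, hK⟩ := isCompact_Icc.exists_bound_of_continuousOn (s := Set.Icc (-1 : ℝ) 1)
    (continuous_val_oneParam Y).continuousOn
  have key : ∀ e ∈ ({1, -1} : Set ℝ), ∃ M, ∀ s, 0 ≤ s → ‖(oneParam Y (s * e) : A)‖ ≤ M := by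
    intro e he
    obtain ⟨M, hM⟩ := hY e
    refine ⟨M * K, fun s hs => ?_⟩
    have h1 : s * e = ⌊s⌋₊ * e + Int.fract s * e := by
      rw [← add_mul, natCast_floor_eq_intCast_floor hs, Int.floor_add_fract]
    rw [h1, oneParam_add, oneParam_nsmul, Units.val_mul, Units.val_pow_eq_pow_val]
    have h2 := Int.fract_nonneg s
    have h3 := Int.fract_lt_one s
    refine (norm_mul_le _ _).trans (mul_le_mul (hM _) (hK _ ?_) (norm_nonneg _)
      ((norm_nonneg _).trans (hM 0)))
    rcases he with rfl | rfl
    · constructor <;> linarith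
    · constructor <;> linarith
  obtain ⟨M₁, h₁⟩ := key 1 (by simp)
  obtain ⟨M₂, h₂⟩ := key (-1) (by simp)
  refine ⟨max M₁ M₂, fun t => ?_⟩
  rcases le_total 0 t with ht | ht
  · have := h₁ t ht
    rw [mul_one] at this
    exact this.trans (le_max_left _ _)
  · have := h₂ (-t) (neg_nonneg.2 ht)
    rw [neg_mul_neg, mul_one] at this
    exact this.trans (le_max_right _ _)

end Flow

/-! ### The commutator action -/

section Commutator

variable {A : Type*} [NormedRing A] [NormedAlgebra ℂ A]

/-- The operator `φ ↦ X φ - φ X`. -/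
noncomputable def commutatorMap (X : A) : A →ₗ[ℂ] A :=
  LinearMap.mulLeft ℂ X - LinearMap.mulRight ℂ X

theorem commutatorMap_apply (X φ : A) : commutatorMap X φ = X * φ - φ * X := rfl

theorem commutatorMap_conj (u : Aˣ) (X φ : A) :
    commutatorMap ((u : A) * X * (u⁻¹ : Aˣ)) ((u : A) * φ * (u⁻¹ : Aˣ)) =
      (u : A) * commutatorMap X φ * (u⁻¹ : Aˣ) := by
  simp only [commutatorMap_apply, mul_sub, sub_mul, mul_assoc, Units.inv_mul_cancel_left]

variable [CompleteSpace A]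

theorem hasDerivAt_conj_oneParam (Y φ : A) (t : ℝ) :
    HasDerivAt (fun t : ℝ => (oneParam Y t : A) * φ * ((oneParam Y t)⁻¹ : Aˣ))
      ((oneParam Y t : A) * commutatorMap Y φ * ((oneParam Y t)⁻¹ : Aˣ)) t := by
  have h1 := (hasDerivAt_oneParam Y t).mul_const φ
  have h2 : HasDerivAt (fun t : ℝ => (((oneParam Y t)⁻¹ : Aˣ) : A))
      (-(Y * ((oneParam Y t)⁻¹ : Aˣ))) t := by
    simp only [oneParam_inv]
    have h3 := (hasDerivAt_oneParam Y (-t)).scomp t (hasDerivAt_neg t)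
    have h4 : Commute (oneParam Y (-t) : A) Y := by
      let _ : NormedAlgebra ℚ A := .restrictScalars ℚ ℝ A
      rw [val_oneParam]
      exact ((Commute.refl Y).smul_left (-t)).exp_left
    rw [neg_one_smul, h4.eq] at h3
    exact h3
  refine (h1.mul h2).congr_deriv ?_
  rw [commutatorMap_apply]
  noncomm_ring

/-- The flow of `commutatorMap Y` is conjugation by `oneParam Y t`, which is bounded because the
inverse is `oneParam Y (-t)`. -/
theorem imaginarySemisimple_commutatorMap {Y : A}
    (hY : ∃ M, ∀ t, ‖(oneParam Y t : A)‖ ≤ M) : ImaginarySemisimple (commutatorMap Y) := by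
  obtain ⟨M, hM⟩ := hY
  have hM0 : 0 ≤ M := (norm_nonneg _).trans (hM 0)
  refine .of_bounded_flow _ (fun t => (LinearMap.mulLeft ℂ (oneParam Y t : A)).comp
    (LinearMap.mulRight ℂ (((oneParam Y t)⁻¹ : Aˣ) : A))) ?_ (fun φ t => ?_) fun φ => ?_
  · ext φ
    simp [oneParam_zero]
  · simp only [LinearMap.comp_apply, LinearMap.mulLeft_apply, LinearMap.mulRight_apply,
      ← mul_assoc]
    exact hasDerivAt_conj_oneParam Y φ t
  · refine ⟨M * (‖φ‖ * M), fun t => ?_⟩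
    simp only [LinearMap.comp_apply, LinearMap.mulLeft_apply, LinearMap.mulRight_apply]
    refine (norm_mul_le _ _).trans (mul_le_mul (hM t) ((norm_mul_le _ _).trans ?_)
      (norm_nonneg _) hM0)
    rw [oneParam_inv]
    exact mul_le_mul_of_nonneg_left (hM _) (norm_nonneg _)

end Commutator

/-! ### Complete reducibility of the connected part via the Casimir operator -/

section LieAlgebraReducible

open Filter Topology

variable {V : Type*} [NormedAddCommGroup V] [NormedSpace ℂ V] [FiniteDimensional ℂ V]

omit [FiniteDimensional ℂ V] in
theorem imaginarySemisimple_of_bounded_oneParam [CompleteSpace (V →L[ℂ] V)] {Y : V →L[ℂ] V}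
    (hY : ∃ M, ∀ t, ‖(oneParam Y t : V →L[ℂ] V)‖ ≤ M) :
    ImaginarySemisimple (Y : V →ₗ[ℂ] V) := by
  obtain ⟨M, hM⟩ := hY
  refine .of_bounded_flow _ (fun t => ((oneParam Y t : V →L[ℂ] V) : V →ₗ[ℂ] V)) ?_
    (fun v t => ?_) fun v => ?_
  · ext v
    simp [oneParam_zero]
  · have h1 := (hasDerivAt_oneParam Y t)
    exact ((ContinuousLinearMap.apply ℂ V v).restrictScalars ℝ).hasFDerivAt.comp_hasDerivAt t h1
  · exact ⟨M * ‖v‖, fun t => ((oneParam Y t : V →L[ℂ] V).le_opNorm v).trans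
      (mul_le_mul_of_nonneg_right (hM t) (norm_nonneg v))⟩

/-- The negative of the real part of the trace form. -/
noncomputable def negReTraceForm (V : Type*) [NormedAddCommGroup V] [NormedSpace ℂ V] :
    (V →L[ℂ] V) →ₗ[ℝ] (V →L[ℂ] V) →ₗ[ℝ] ℝ :=
  LinearMap.mk₂ ℝ (fun X Y => -(LinearMap.trace ℂ V ((X : V →ₗ[ℂ] V) * (Y : V →ₗ[ℂ] V))).re)
    (fun X X' Y => by simp [add_mul, add_comm])
    (fun c X Y => by
      have : ((c • X : V →L[ℂ] V) : V →ₗ[ℂ] V) = (c : ℂ) • (X : V →ₗ[ℂ] V) := by ext; simp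
      rw [this, smul_mul_assoc, map_smul]
      simp)
    (fun X Y Y' => by simp [mul_add, add_comm])
    (fun c X Y => by
      have : ((c • Y : V →L[ℂ] V) : V →ₗ[ℂ] V) = (c : ℂ) • (Y : V →ₗ[ℂ] V) := by ext; simp
      rw [this, mul_smul_comm, map_smul]
      simp)

omit [FiniteDimensional ℂ V] in
theorem negReTraceForm_apply (X Y : V →L[ℂ] V) : negReTraceForm V X Y =
    -(LinearMap.trace ℂ V ((X : V →ₗ[ℂ] V) * (Y : V →ₗ[ℂ] V))).re := rfl

omit [FiniteDimensional ℂ V] in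
theorem negReTraceForm_conj (u : (V →L[ℂ] V)ˣ) (X Y : V →L[ℂ] V) :
    negReTraceForm V ((u : V →L[ℂ] V) * X * ((u⁻¹ : (V →L[ℂ] V)ˣ) : V →L[ℂ] V))
      ((u : V →L[ℂ] V) * Y * ((u⁻¹ : (V →L[ℂ] V)ˣ) : V →L[ℂ] V)) = negReTraceForm V X Y := by
  rw [negReTraceForm_apply, negReTraceForm_apply]
  have h : ((((u : V →L[ℂ] V) * X * ((u⁻¹ : (V →L[ℂ] V)ˣ) : V →L[ℂ] V) : V →L[ℂ] V) :
      V →ₗ[ℂ] V) * (((u : V →L[ℂ] V) * Y * ((u⁻¹ : (V →L[ℂ] V)ˣ) : V →L[ℂ] V) : V →L[ℂ] V) :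
      V →ₗ[ℂ] V)) = (((u : V →L[ℂ] V) * X * Y : V →L[ℂ] V) : V →ₗ[ℂ] V) *
      (((u⁻¹ : (V →L[ℂ] V)ˣ) : V →L[ℂ] V) : V →ₗ[ℂ] V) := by
    rw [← ContinuousLinearMap.toLinearMap_mul, ← ContinuousLinearMap.toLinearMap_mul]
    congr 1
    simp only [mul_assoc, Units.inv_mul_cancel_left]
  have h' : (((u⁻¹ : (V →L[ℂ] V)ˣ) : V →L[ℂ] V) : V →ₗ[ℂ] V) *
      (((u : V →L[ℂ] V) * X * Y : V →L[ℂ] V) : V →ₗ[ℂ] V) =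
      (X : V →ₗ[ℂ] V) * (Y : V →ₗ[ℂ] V) := by
    rw [← ContinuousLinearMap.toLinearMap_mul, ← ContinuousLinearMap.toLinearMap_mul]
    congr 1
    simp only [mul_assoc, Units.inv_mul_cancel_left]
  rw [h, LinearMap.trace_mul_comm, h']

theorem negReTraceForm_pos [CompleteSpace (V →L[ℂ] V)] {Y : V →L[ℂ] V}
    (hY : ∃ M, ∀ t, ‖(oneParam Y t : V →L[ℂ] V)‖ ≤ M) (hne : Y ≠ 0) :
    0 < negReTraceForm V Y Y := by
  have h := imaginarySemisimple_of_bounded_oneParam hY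
  rw [negReTraceForm_apply]
  refine neg_pos.2 (lt_of_le_of_ne h.trace_sq_re_nonpos fun h0 => hne ?_)
  have := h.eq_zero_of_trace_sq h0
  ext v
  exact LinearMap.congr_fun this v

/-- Operators with range in `W` which are scalar on `W`. -/
def scalarOn (W : Submodule ℂ V) : Submodule ℂ (V →L[ℂ] V) where
  carrier := {φ | (∀ v, φ v ∈ W) ∧ ∃ c : ℂ, ∀ w ∈ W, φ w = c • w}
  zero_mem' := ⟨fun v => W.zero_mem, 0, fun w _ => by simp⟩
  add_mem' := by
    rintro φ ψ ⟨h1, c, hc⟩ ⟨h2, d, hd⟩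
    refine ⟨fun v => W.add_mem (h1 v) (h2 v), c + d, fun w hw => ?_⟩
    rw [add_apply, hc w hw, hd w hw, add_smul]
  smul_mem' := by
    rintro a φ ⟨h1, c, hc⟩
    refine ⟨fun v => W.smul_mem a (h1 v), a * c, fun w hw => ?_⟩
    rw [smul_apply, hc w hw, smul_smul]

omit [FiniteDimensional ℂ V] in
theorem commutatorMap_apply_of_mem {W : Submodule ℂ V} {X : V →L[ℂ] V} (hX : ∀ w ∈ W, X w ∈ W)
    {φ : V →L[ℂ] V} (hφ : φ ∈ scalarOn W) {w : V} (hw : w ∈ W) : commutatorMap X φ w = 0 := by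
  obtain ⟨-, c, hc⟩ := hφ
  change X (φ w) - φ (X w) = 0
  rw [hc w hw, hc _ (hX w hw), map_smul, sub_self]

omit [FiniteDimensional ℂ V] in
theorem commutatorMap_mem_scalarOn {W : Submodule ℂ V} {X : V →L[ℂ] V} (hX : ∀ w ∈ W, X w ∈ W)
    {φ : V →L[ℂ] V} (hφ : φ ∈ scalarOn W) : commutatorMap X φ ∈ scalarOn W := by
  refine ⟨fun v => ?_, 0, fun w hw => ?_⟩
  · change X (φ v) - φ (X v) ∈ W
    exact W.sub_mem (hX _ (hφ.1 v)) (hφ.1 _)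
  · rw [commutatorMap_apply_of_mem hX hφ hw, zero_smul]

theorem mapsTo_of_oneParam_mapsTo [CompleteSpace (V →L[ℂ] V)] {W : Submodule ℂ V}
    {Y : V →L[ℂ] V} (h : ∀ t, ∀ w ∈ W, (oneParam Y t : V →L[ℂ] V) w ∈ W) :
    ∀ w ∈ W, Y w ∈ W := by
  intro w hw
  have h1 := tendsto_oneParam_slope Y (s := fun k : ℕ => 1 / ((k : ℝ) + 1))
    (fun k => by positivity) tendsto_one_div_add_atTop_nhds_zero_nat
  have h2 := ((ContinuousLinearMap.apply ℂ V w).continuous.tendsto _).comp h1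
  refine W.closed_of_finiteDimensional.mem_of_tendsto h2 (Eventually.of_forall fun k => ?_)
  simp only [Function.comp_apply, ContinuousLinearMap.apply_apply, smul_apply, sub_apply,
    one_apply_eq_self]
  exact (W.restrictScalars ℝ).smul_mem _ (W.sub_mem (h _ w hw) hw)

variable [CompleteSpace (V →L[ℂ] V)]

/-- The Casimir operator of the trace form, acting by commutators. -/
noncomputable def casimir {ι : Type*} [Fintype ι] (b : ι → V →L[ℂ] V) :
    (V →L[ℂ] V) →ₗ[ℂ] (V →L[ℂ] V) :=
  ∑ i, commutatorMap (b i) ∘ₗ commutatorMap (b i)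

omit [FiniteDimensional ℂ V] [CompleteSpace (V →L[ℂ] V)] in
-- Conjugation by `u` preserves `𝔤` and the trace form, so it only exchanges one orthonormal basis
-- for another.
theorem casimir_conj {G : Subgroup (V →L[ℂ] V)ˣ} {𝔤 : Submodule ℝ (V →L[ℂ] V)}
    (h𝔤 : ∀ u ∈ G, ∀ X ∈ 𝔤, (u : V →L[ℂ] V) * X * ((u⁻¹ : (V →L[ℂ] V)ˣ) : V →L[ℂ] V) ∈ 𝔤)
    {ι : Type*} [Fintype ι] [DecidableEq ι] (b : Module.Basis ι ℝ 𝔤)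
    (hb : ∀ i j, negReTraceForm V (b i) (b j) = if i = j then 1 else 0)
    {u : (V →L[ℂ] V)ˣ} (hu : u ∈ G) (φ : V →L[ℂ] V) :
    casimir (fun i => (b i : V →L[ℂ] V))
        ((u : V →L[ℂ] V) * φ * ((u⁻¹ : (V →L[ℂ] V)ˣ) : V →L[ℂ] V)) =
      (u : V →L[ℂ] V) * casimir (fun i => (b i : V →L[ℂ] V)) φ *
        ((u⁻¹ : (V →L[ℂ] V)ˣ) : V →L[ℂ] V) := by
  let B : 𝔤 →ₗ[ℝ] 𝔤 →ₗ[ℝ] ℝ := (negReTraceForm V).compl₁₂ 𝔤.subtype 𝔤.subtype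
  let ψ := (u : V →L[ℂ] V) * φ * ((u⁻¹ : (V →L[ℂ] V)ˣ) : V →L[ℂ] V)
  let f : 𝔤 →ₗ[ℝ] 𝔤 →ₗ[ℝ] (V →L[ℂ] V) :=
    LinearMap.mk₂ ℝ (fun X Y => commutatorMap (X : V →L[ℂ] V) (commutatorMap (Y : V →L[ℂ] V) ψ))
      (fun X X' Y => by simp only [commutatorMap_apply, Submodule.coe_add]; noncomm_ring)
      (fun c X Y => by
        simp only [commutatorMap_apply, Submodule.coe_smul, smul_mul_assoc, mul_smul_comm,
          smul_sub])
      (fun X Y Y' => by simp only [commutatorMap_apply, Submodule.coe_add]; noncomm_ring)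
      (fun c X Y => by
        simp only [commutatorMap_apply, Submodule.coe_smul, smul_mul_assoc, mul_smul_comm,
          smul_sub, mul_sub, sub_mul])
  have key := sum_apply_isometry (B := B) hb f
    (fun X => ⟨(u : V →L[ℂ] V) * X * ((u⁻¹ : (V →L[ℂ] V)ˣ) : V →L[ℂ] V), h𝔤 u hu X X.2⟩)
    (fun X Y => negReTraceForm_conj u X Y)
  rw [casimir, LinearMap.sum_apply, LinearMap.sum_apply, Finset.mul_sum, Finset.sum_mul]
  refine key.symm.trans (Finset.sum_congr rfl fun i _ => ?_)
  change commutatorMap _ (commutatorMap _ ψ) = _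
  simp only [ψ, commutatorMap_conj, LinearMap.comp_apply]

/-- The derivative at `t = 0` of `casimir_conj` along `oneParam Y t`. -/
theorem commutatorMap_casimir {G : Subgroup (V →L[ℂ] V)ˣ} {𝔤 : Submodule ℝ (V →L[ℂ] V)}
    (h𝔤 : ∀ u ∈ G, ∀ X ∈ 𝔤, (u : V →L[ℂ] V) * X * ((u⁻¹ : (V →L[ℂ] V)ˣ) : V →L[ℂ] V) ∈ 𝔤)
    {ι : Type*} [Fintype ι] [DecidableEq ι] (b : Module.Basis ι ℝ 𝔤)
    (hb : ∀ i j, negReTraceForm V (b i) (b j) = if i = j then 1 else 0)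
    {Y : V →L[ℂ] V} (hY : ∀ t, oneParam Y t ∈ G) (φ : V →L[ℂ] V) :
    commutatorMap Y (casimir (fun i => (b i : V →L[ℂ] V)) φ) =
      casimir (fun i => (b i : V →L[ℂ] V)) (commutatorMap Y φ) := by
  set Ω := casimir (fun i => (b i : V →L[ℂ] V))
  have h1 := hasDerivAt_conj_oneParam Y (Ω φ) 0
  have h2 := ((LinearMap.toContinuousLinearMap Ω).restrictScalars ℝ).hasFDerivAt.comp_hasDerivAt
    0 (hasDerivAt_conj_oneParam Y φ 0)
  have h3 := h1.unique (h2.congr_of_eventuallyEq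
    (Eventually.of_forall fun t => (casimir_conj h𝔤 b hb (hY t) φ).symm))
  simpa [oneParam_zero] using h3

/-- Any projection `q` onto an invariant `W` lies in `scalarOn W`, on which the Lie algebra acts by
commutators. The component of `q` fixed by this action is the equivariant projection. -/
theorem completelyReducible_connectedPart {G : Subgroup (V →L[ℂ] V)ˣ}
    (hG : IsClosed (G : Set (V →L[ℂ] V)ˣ)) (hpb : ∀ g ∈ G, PowerBounded (g : V →L[ℂ] V)) :
    CompletelyReducible (connectedPart G) := by
  refine CompletelyReducible.topologicalClosure fun W hW => ?_
  set 𝔤 := tangentSpace G hG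
  have hbdd : ∀ X ∈ 𝔤, ∃ M, ∀ t, ‖(oneParam X t : V →L[ℂ] V)‖ ≤ M := fun X hX =>
    exists_forall_norm_oneParam_le fun t => hpb _ (hX t)
  have hWX : ∀ X ∈ 𝔤, ∀ w ∈ W, X w ∈ W := fun X hX =>
    mapsTo_of_oneParam_mapsTo fun t => hW _ (Subgroup.subset_closure ⟨X, hX, t, rfl⟩)
  obtain ⟨b, hb⟩ := exists_basis_orthonormal
    ((negReTraceForm V).compl₁₂ 𝔤.subtype 𝔤.subtype)
    (fun X Y => by
      change -(LinearMap.trace ℂ V _).re = -(LinearMap.trace ℂ V _).re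
      rw [LinearMap.trace_mul_comm])
    (fun X hX => negReTraceForm_pos (hbdd X X.2) (by simpa using hX))
  let ρ : 𝔤 →ₗ[ℝ] Module.End ℂ (scalarOn W) :=
    { toFun := fun X => (commutatorMap (X : V →L[ℂ] V)).restrict fun φ hφ =>
        commutatorMap_mem_scalarOn (hWX X X.2) hφ
      map_add' := fun X Y => by
        ext1 φ
        refine Subtype.ext ?_
        change commutatorMap ((X : V →L[ℂ] V) + Y) (φ : V →L[ℂ] V) =
          commutatorMap (X : V →L[ℂ] V) φ + commutatorMap (Y : V →L[ℂ] V) φ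
        simp only [commutatorMap_apply]
        noncomm_ring
      map_smul' := fun c X => by
        ext1 φ
        refine Subtype.ext ?_
        change commutatorMap (c • (X : V →L[ℂ] V)) (φ : V →L[ℂ] V) =
          c • commutatorMap (X : V →L[ℂ] V) φ
        simp only [commutatorMap_apply, smul_mul_assoc, mul_smul_comm, smul_sub] }
  have hρ : ∀ (X : 𝔤) (φ : scalarOn W),
      ((ρ X φ : scalarOn W) : V →L[ℂ] V) = commutatorMap (X : V →L[ℂ] V) φ := fun _ _ => rfl
  have hΩ : ∀ φ : scalarOn W, (((∑ i, ρ (b i) * ρ (b i)) φ : scalarOn W) : V →L[ℂ] V) =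
      casimir (fun i => (b i : V →L[ℂ] V)) φ := by
    intro φ
    rw [casimir, LinearMap.sum_apply, LinearMap.sum_apply, Submodule.coe_sum]
    rfl
  obtain ⟨W', hW'⟩ := W.exists_isCompl
  obtain ⟨q, hq⟩ : ∃ q : V →L[ℂ] V, IsProjectionOnto q W := by
    refine ⟨LinearMap.toContinuousLinearMap (W.subtype ∘ₗ W.projectionOnto W' hW'),
      fun v => Subtype.mem _, fun w hw => ?_⟩
    exact congrArg Subtype.val (Submodule.projectionOnto_apply_left hW' ⟨w, hw⟩)
  obtain ⟨z, hz, y, hy⟩ := exists_fixed_add_range ρ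
    (fun X => (imaginarySemisimple_commutatorMap (hbdd X X.2)).restrict
      fun φ hφ => commutatorMap_mem_scalarOn (hWX X X.2) hφ) b
    (fun X => LinearMap.ext fun φ => Subtype.ext (by
      rw [Module.End.mul_apply, Module.End.mul_apply, hΩ, hρ, hρ, hΩ]
      exact (commutatorMap_casimir (fun u hu X hX => conj_mem_tangentSpace hu hX) b hb X.2
        _).symm)) ⟨q, hq.1, 1, fun w hw => by rw [hq.2 w hw, one_smul]⟩
  refine ⟨z, ⟨z.2.1, fun w hw => ?_⟩, (Subgroup.closure_le _).2 ?_⟩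
  -- Commutators with operators scalar on `W` vanish on `W`, so the Casimir term contributes nothing
  -- there and `z` agrees with `q` on `W`.
  · have h1 := congrArg (fun φ : scalarOn W => (φ : V →L[ℂ] V) w) hy
    simp only [Submodule.coe_add, add_apply, hΩ, hq.2 w hw] at h1
    rw [casimir, LinearMap.sum_apply, sum_apply, Finset.sum_eq_zero, add_zero] at h1
    · exact h1.symm
    · intro i _
      exact commutatorMap_apply_of_mem (hWX _ (b i).2)
        (commutatorMap_mem_scalarOn (hWX _ (b i).2) y.2) hw
  · rintro _ ⟨Y, hY, t, rfl⟩
    have h1 : commutatorMap Y (z : V →L[ℂ] V) = 0 := congrArg Subtype.val (hz ⟨Y, hY⟩)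
    have h2 : Commute Y (z : V →L[ℂ] V) := sub_eq_zero.1 h1
    let _ : NormedAlgebra ℚ (V →L[ℂ] V) := .restrictScalars ℚ ℝ _
    exact (h2.smul_left t).exp_left

end LieAlgebraReducible

open scoped commutatorElement

/-! ### Nilpotency from iterated commutators of generators -/

section Nilpotent

/-- Left-normed iterated commutators of elements of `S`. -/
def iterCommutators {G : Type*} [Group G] (S : Set G) : ℕ → Set G
  | 0 => S
  | n + 1 => {z | ∃ x ∈ iterCommutators S n, ∃ s ∈ S, z = ⁅x, s⁆}

theorem map_iterCommutators {G Q : Type*} [Group G] [Group Q] (f : G →* Q) (S : Set G) (n : ℕ) :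
    ∀ z ∈ iterCommutators (f '' S) n, ∃ x ∈ iterCommutators S n, f x = z := by
  induction n with
  | zero => exact fun z hz => hz
  | succ n ih =>
    rintro _ ⟨x, hx, _, ⟨s, hs, rfl⟩, rfl⟩
    obtain ⟨y, hy, rfl⟩ := ih x hx
    exact ⟨⁅y, s⁆, ⟨y, hy, s, hs, rfl⟩, map_commutatorElement f y s⟩

/-- Level `k - i` lies in the `i`-th upper central term, by induction on `i`. Commuting with
generators modulo that term is enough, since a centraliser is a subgroup. -/
theorem isNilpotent_of_iterCommutators {G : Type*} [Group G] {S : Set G}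
    (hS : Subgroup.closure S = ⊤) {k : ℕ} (hk : ∀ x ∈ iterCommutators S k, x = 1) :
    Group.IsNilpotent G := by
  have key : ∀ i ≤ k, iterCommutators S (k - i) ⊆ Subgroup.upperCentralSeries G i := by
    intro i
    induction i with
    | zero =>
      intro _ x hx
      rw [hk x hx]
      exact one_mem _
    | succ i ih =>
      intro hi x hx
      rw [SetLike.mem_coe, Subgroup.mem_upperCentralSeries_succ_iff]
      let Z := Subgroup.upperCentralSeries G i
      have h1 : (⊤ : Subgroup G) ≤ (Subgroup.centralizer {(x : G ⧸ Z)}).comap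
          (QuotientGroup.mk' Z) := by
        rw [← hS, Subgroup.closure_le]
        intro s hs
        have h2 : ⁅x, s⁆ ∈ Z := by
          refine ih (by omega) ?_
          have e : k - i = k - (i + 1) + 1 := by omega
          rw [e]
          exact ⟨x, hx, s, hs, rfl⟩
        rw [SetLike.mem_coe, Subgroup.mem_comap, Subgroup.mem_centralizer_singleton_iff]
        have h3 : ((⁅x, s⁆ : G) : G ⧸ Z) = 1 := (QuotientGroup.eq_one_iff _).2 h2
        have h4 : ⁅(x : G ⧸ Z), (s : G ⧸ Z)⁆ = 1 := h3
        exact (commutatorElement_eq_one_iff_mul_comm.1 h4).symm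
      intro y
      have h2 := h1 (Subgroup.mem_top y)
      rw [Subgroup.mem_comap, Subgroup.mem_centralizer_singleton_iff] at h2
      refine (QuotientGroup.eq_one_iff _).1 ?_
      change ⁅(x : G ⧸ Z), (y : G ⧸ Z)⁆ = 1
      exact commutatorElement_eq_one_iff_mul_comm.2 h2.symm
  refine ⟨k, top_unique ?_⟩
  rw [← hS, Subgroup.closure_le]
  have := key k le_rfl
  rwa [Nat.sub_self] at this

end Nilpotent

/-! ### Complete reducibility through torsion nilpotent quotients -/

section CompletelyReducibleTower

variable {V : Type*} [NormedAddCommGroup V] [NormedSpace ℂ V]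

/-- The linear span of a group of operators. -/
def operatorSpan (H : Subgroup (V →L[ℂ] V)ˣ) : Submodule ℂ (V →L[ℂ] V) :=
  Submodule.span ℂ ((fun u : (V →L[ℂ] V)ˣ => (u : V →L[ℂ] V)) '' H)

theorem mem_operatorSpan {H : Subgroup (V →L[ℂ] V)ˣ} {u : (V →L[ℂ] V)ˣ} (hu : u ∈ H) :
    (u : V →L[ℂ] V) ∈ operatorSpan H := Submodule.subset_span ⟨u, hu, rfl⟩

theorem operatorSpan_mono {H K : Subgroup (V →L[ℂ] V)ˣ} (h : H ≤ K) :
    operatorSpan H ≤ operatorSpan K := Submodule.span_mono (Set.image_mono h)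

/-- The operator space is Noetherian, so spans cannot grow forever. Maximising the span, rather than
the group, is what `CompletelyReducible.of_subset_span` needs. -/
theorem exists_maximal_operatorSpan [FiniteDimensional ℂ V]
    (P : Subgroup (V →L[ℂ] V)ˣ → Prop) {M : Subgroup (V →L[ℂ] V)ˣ} (hM : P M) :
    ∃ N, P N ∧ ∀ K, P K → N ≤ K → ∀ u ∈ K, (u : V →L[ℂ] V) ∈ operatorSpan N := by
  obtain ⟨_, ⟨N, hN, rfl⟩, hmax⟩ := set_has_maximal_iff_noetherian.2
    (inferInstance : IsNoetherian ℂ (V →L[ℂ] V)) (operatorSpan '' {K | P K}) ⟨_, M, hM, rfl⟩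
  refine ⟨N, hN, fun K hK hNK u hu => ?_⟩
  by_contra hne
  refine hmax _ ⟨K, hK, rfl⟩ (lt_of_le_of_ne (operatorSpan_mono hNK) fun h => hne ?_)
  rw [h]
  exact mem_operatorSpan hu

variable [FiniteDimensional ℂ V]

/-- Every group between `M` and `N` is normalised by `N`, so elements of `N` can be adjoined one at
a time by `sup_zpowers`. Once the span is maximal, the rest of `N` comes for free. -/
theorem CompletelyReducible.of_commutator_le {M N : Subgroup (V →L[ℂ] V)ˣ}
    (hM : CompletelyReducible M) (hMN : M ≤ N) (hcomm : ∀ a ∈ N, ∀ b ∈ N, ⁅a, b⁆ ∈ M)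
    (htors : ∀ x ∈ N, ∃ n, 0 < n ∧ x ^ n ∈ M) : CompletelyReducible N := by
  obtain ⟨P, ⟨hP, hMP, hPN⟩, hmax⟩ := exists_maximal_operatorSpan
    (fun P => CompletelyReducible P ∧ M ≤ P ∧ P ≤ N) (M := M) ⟨hM, le_rfl, hMN⟩
  refine hP.of_subset_span hPN fun x hx => ?_
  obtain ⟨n, hn, hxn⟩ := htors x hx
  refine hmax (P ⊔ Subgroup.zpowers x) ⟨hP.sup_zpowers (fun m hm => ?_) hn (hMP hxn),
    hMP.trans le_sup_left, sup_le hPN (by simpa using hx)⟩ le_sup_left x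
    ((le_sup_right : _ ≤ P ⊔ Subgroup.zpowers x) (Subgroup.mem_zpowers x))
  have h1 : ⁅x⁻¹, m⁆ ∈ P := hMP (hcomm _ (N.inv_mem hx) _ (hPN hm))
  have h2 : x⁻¹ * m * x = ⁅x⁻¹, m⁆ * m := by rw [commutatorElement_def]; group
  rw [h2]
  exact P.mul_mem h1 hm

theorem CompletelyReducible.of_isNilpotent_quotient {G : Type*} [Group G]
    (f : G →* (V →L[ℂ] V)ˣ) (N : Subgroup G) [N.Normal] (hN : CompletelyReducible (N.map f))
    [hnil : Group.IsNilpotent (G ⧸ N)] (htors : ∀ g : G, ∃ n, 0 < n ∧ g ^ n ∈ N) :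
    CompletelyReducible f.range := by
  let Z : ℕ → Subgroup G := fun i =>
    (Subgroup.upperCentralSeries (G ⧸ N) i).comap (QuotientGroup.mk' N)
  have hNZ : ∀ i, N ≤ Z i := by
    intro i x hx
    change (x : G ⧸ N) ∈ Subgroup.upperCentralSeries (G ⧸ N) i
    rw [(QuotientGroup.eq_one_iff x).2 hx]
    exact one_mem _
  have key : ∀ i, CompletelyReducible ((Z i).map f) := by
    intro i
    induction i with
    | zero =>
      have : Z 0 = N := by
        simp only [Z, Subgroup.upperCentralSeries_zero]
        rw [MonoidHom.comap_bot, QuotientGroup.ker_mk']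
      rwa [this]
    | succ i ih =>
      refine ih.of_commutator_le (Subgroup.map_mono (Subgroup.comap_mono ?_)) ?_ ?_
      · exact Subgroup.upperCentralSeries_mono _ (Nat.le_succ i)
      · rintro _ ⟨a, ha, rfl⟩ _ ⟨b, -, rfl⟩
        refine ⟨⁅a, b⁆, ?_, map_commutatorElement f a b⟩
        exact Subgroup.mem_upperCentralSeries_succ_iff.1 ha (b : G ⧸ N)
      · rintro _ ⟨a, -, rfl⟩
        obtain ⟨n, hn, h⟩ := htors a
        exact ⟨n, hn, a ^ n, hNZ i h, map_pow f a n⟩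
  obtain ⟨k, hk⟩ := hnil
  have h := key k
  have hZ : Z k = ⊤ := by
    simp only [Z, hk, Subgroup.comap_top]
  rwa [hZ, ← MonoidHom.range_eq_map] at h

end CompletelyReducibleTower

/-! ### Commutators contract near the identity -/

section Contraction

variable {A : Type*} [NormedRing A]

theorem Units.norm_inv_le_two (h1 : ‖(1 : A)‖ ≤ 1) {u : Aˣ} (hu : ‖(u : A) - 1‖ ≤ 1 / 2) :
    ‖((u⁻¹ : Aˣ) : A)‖ ≤ 2 := by
  have e : ((u⁻¹ : Aˣ) : A) = 1 - (u⁻¹ : Aˣ) * ((u : A) - 1) := by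
    rw [mul_sub, Units.inv_mul, mul_one, sub_sub_cancel]
  have h2 : ‖((u⁻¹ : Aˣ) : A)‖ ≤ 1 + ‖((u⁻¹ : Aˣ) : A)‖ * (1 / 2) := by
    conv_lhs => rw [e]
    refine (norm_sub_le _ _).trans (add_le_add h1 ((norm_mul_le _ _).trans ?_))
    exact mul_le_mul_of_nonneg_left hu (norm_nonneg _)
  linarith

/-- `⁅u, v⁆ - 1` is the ring commutator of `u - 1` and `v - 1` times `u⁻¹ * v⁻¹`. The ring
commutator costs a factor 2 and each inverse another 2. -/
theorem Units.norm_commutator_sub_one_le (h1 : ‖(1 : A)‖ ≤ 1) {u v : Aˣ} {a b : ℝ}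
    (hu : ‖(u : A) - 1‖ ≤ a) (hv : ‖(v : A) - 1‖ ≤ b) (ha : a ≤ 1 / 2) (hb : b ≤ 1 / 2) :
    ‖((⁅u, v⁆ : Aˣ) : A) - 1‖ ≤ 8 * (a * b) := by
  have ha0 : 0 ≤ a := (norm_nonneg _).trans hu
  have hb0 : 0 ≤ b := (norm_nonneg _).trans hv
  have e : ((⁅u, v⁆ : Aˣ) : A) - 1 = (((u : A) - 1) * ((v : A) - 1) -
      ((v : A) - 1) * ((u : A) - 1)) * (u⁻¹ : Aˣ) * (v⁻¹ : Aˣ) := by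
    have e1 : ((u : A) - 1) * ((v : A) - 1) - ((v : A) - 1) * ((u : A) - 1) =
        (u : A) * v - v * u := by noncomm_ring
    rw [e1, sub_mul, sub_mul, commutatorElement_def]
    simp only [Units.val_mul, Units.mul_inv_cancel_right, Units.mul_inv]
  rw [e]
  have h3 : ‖((u : A) - 1) * ((v : A) - 1) - ((v : A) - 1) * ((u : A) - 1)‖ ≤ a * b + b * a :=
    (norm_sub_le _ _).trans (add_le_add
      ((norm_mul_le _ _).trans (mul_le_mul hu hv (norm_nonneg _) ha0))
      ((norm_mul_le _ _).trans (mul_le_mul hv hu (norm_nonneg _) hb0)))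
  have h4 := norm_mul_le (((u : A) - 1) * ((v : A) - 1) - ((v : A) - 1) * ((u : A) - 1))
    ((u⁻¹ : Aˣ) : A)
  have h5 := norm_mul_le ((((u : A) - 1) * ((v : A) - 1) - ((v : A) - 1) * ((u : A) - 1)) *
    ((u⁻¹ : Aˣ) : A)) ((v⁻¹ : Aˣ) : A)
  have h6 := Units.norm_inv_le_two h1 (hu.trans ha)
  have h7 := Units.norm_inv_le_two h1 (hv.trans hb)
  have h8 : 0 ≤ a * b + b * a := by positivity
  calc _ ≤ _ := h5
    _ ≤ (a * b + b * a) * 2 * 2 :=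
      mul_le_mul (h4.trans (mul_le_mul h3 h6 (norm_nonneg _) h8)) h7 (norm_nonneg _)
        (by positivity)
    _ = 8 * (a * b) := by ring

/-- Radius 1/16 turns the constant 8 into a contraction ratio of 1/2. -/
theorem norm_sub_one_le_of_mem_iterCommutators (h1 : ‖(1 : A)‖ ≤ 1) {S : Set Aˣ}
    (hS : ∀ s ∈ S, ‖(s : A) - 1‖ ≤ 1 / 16) (n : ℕ) :
    ∀ x ∈ iterCommutators S n, ‖(x : A) - 1‖ ≤ 1 / 16 * (1 / 2) ^ n := by
  induction n with
  | zero => exact fun x hx => (hS x hx).trans (by norm_num)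
  | succ n ih =>
    rintro _ ⟨x, hx, s, hs, rfl⟩
    have h2 : (1 / 2 : ℝ) ^ n ≤ 1 := pow_le_one₀ (by norm_num) (by norm_num)
    refine (Units.norm_commutator_sub_one_le h1 (ih x hx) (hS s hs) (by linarith)
      (by norm_num)).trans (le_of_eq ?_)
    rw [pow_succ]
    ring

/-- Undoing the conjugation by `d` costs the factor `‖d‖ * ‖d⁻¹‖`, which does not depend on the
level and is beaten by the geometric decay. -/
theorem exists_iterCommutators_small (h1 : ‖(1 : A)‖ ≤ 1) {S : Set Aˣ} (d : Aˣ)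
    (hS : ∀ s ∈ S, ‖((d⁻¹ * s * d : Aˣ) : A) - 1‖ ≤ 1 / 16) {δ : ℝ} (hδ : 0 < δ) :
    ∃ k, ∀ x ∈ iterCommutators S k, ‖(x : A) - 1‖ < δ := by
  let c : Aˣ →* Aˣ := (MulAut.conj d).toMonoidHom
  let c' : Aˣ →* Aˣ := (MulAut.conj d⁻¹).toMonoidHom
  have hc' : ∀ s, c' s = d⁻¹ * s * d := fun s => by simp [c']
  have hcS : c '' (c' '' S) = S := by
    rw [Set.image_image]
    have : ∀ s, c (c' s) = s := fun s => by
      rw [hc']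
      simp [c, MulAut.conj_apply, mul_assoc]
    simp [this]
  have hsmall : ∀ s ∈ c' '' S, ‖(s : A) - 1‖ ≤ 1 / 16 := by
    rintro _ ⟨s, hs, rfl⟩
    rw [hc']
    exact hS s hs
  have hlim : Filter.Tendsto (fun k : ℕ => ‖(d : A)‖ * (1 / 16 * (1 / 2) ^ k) *
      ‖((d⁻¹ : Aˣ) : A)‖) Filter.atTop (nhds 0) := by
    have := tendsto_pow_atTop_nhds_zero_of_lt_one (r := (1 / 2 : ℝ)) (by norm_num) (by norm_num)
    have h2 := ((this.const_mul (1 / 16)).const_mul ‖(d : A)‖).mul_const ‖((d⁻¹ : Aˣ) : A)‖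
    rwa [mul_zero, mul_zero, zero_mul] at h2
  obtain ⟨k, hk⟩ := (hlim.eventually (gt_mem_nhds hδ)).exists
  refine ⟨k, fun x hx => lt_of_le_of_lt ?_ hk⟩
  rw [← hcS] at hx
  obtain ⟨y, hy, rfl⟩ := map_iterCommutators c _ k x hx
  have h2 := norm_sub_one_le_of_mem_iterCommutators h1 hsmall k y hy
  have h3 : ((c y : Aˣ) : A) - 1 = (d : A) * ((y : A) - 1) * (d⁻¹ : Aˣ) := by
    rw [mul_sub, sub_mul, mul_one, Units.mul_inv]
    rfl
  rw [h3]
  refine (norm_mul_le _ _).trans (mul_le_mul_of_nonneg_right ((norm_mul_le _ _).trans ?_)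
    (norm_nonneg _))
  exact mul_le_mul_of_nonneg_left h2 (norm_nonneg _)

end Contraction

/-! ### Burnside's theorem -/

section Burnside

/-- **Burnside's theorem**: an irreducible monoid of operators spans all operators. -/
theorem span_eq_top_of_irreducible {V G : Type*} [AddCommGroup V] [Module ℂ V]
    [FiniteDimensional ℂ V] [Nontrivial V] [Monoid G] (ρ : G →* Module.End ℂ V)
    (hirr : ∀ W : Submodule ℂ V, (∀ g, ∀ w ∈ W, ρ g w ∈ W) → W = ⊥ ∨ W = ⊤) :
    Submodule.span ℂ (Set.range ρ) = ⊤ := by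
  classical
  let A := Algebra.adjoin ℂ (Set.range ρ)
  have hA : Subalgebra.toSubmodule A = Submodule.span ℂ (Set.range ρ) := by
    rw [Algebra.adjoin_eq_span, ← MonoidHom.coe_mrange, Submonoid.closure_eq]
  have hsimple : IsSimpleModule A V := by
    rw [isSimpleModule_iff]
    refine { exists_pair_ne := ⟨⊥, ⊤, bot_ne_top⟩, eq_bot_or_eq_top := fun W => ?_ }
    rcases hirr (W.restrictScalars ℂ) (fun g w hw =>
      W.smul_mem (⟨ρ g, Algebra.subset_adjoin ⟨g, rfl⟩⟩ : A) hw) with h | h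
    · exact Or.inl ((Submodule.restrictScalars_eq_bot_iff _ _ _).1 h)
    · exact Or.inr ((Submodule.restrictScalars_eq_top_iff _ _ _).1 h)
  rw [← hA]
  refine top_unique fun f _ => ?_
  -- By Schur's lemma the endomorphisms of the simple module are scalars, so any `f` is linear over
  -- them; density then matches `f` with an element of `A` on a basis.
  let F : Module.End (Module.End A V) V :=
    { toFun := f
      map_add' := map_add f
      map_smul' := fun a v => by
        obtain ⟨c, rfl⟩ := (IsSimpleModule.algebraMap_end_bijective_of_isAlgClosed
          (A := A) (V := V) ℂ).2 a
        change f (c • v) = c • f v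
        exact map_smul f c v }
  let b := Module.finBasis ℂ V
  obtain ⟨r, hr⟩ := jacobson_density F (Finset.univ.image b)
  have hfr : f = (r : Module.End ℂ V) := b.ext fun i =>
    hr (b i) (Finset.mem_image_of_mem b (Finset.mem_univ i))
  rw [hfr]
  exact r.2

end Burnside

/-! ### Uniform bounds for completely reducible groups -/

section PowerBounded

variable {V : Type*} [NormedAddCommGroup V] [NormedSpace ℂ V] [FiniteDimensional ℂ V]

omit [FiniteDimensional ℂ V] in
theorem PowerBounded.norm_eigenvalue_le {T : V →L[ℂ] V} (hT : PowerBounded T) {c : ℂ} {v : V}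
    (hv : v ≠ 0) (h : T v = c • v) : ‖c‖ ≤ 1 := by
  obtain ⟨M, hM⟩ := hT
  by_contra! hc
  obtain ⟨m, hm⟩ := pow_unbounded_of_one_lt M hc
  have h1 : (T ^ m) v = c ^ m • v := by
    clear hm
    induction m with
    | zero => simp
    | succ m ih =>
      rw [pow_succ']
      change T ((T ^ m) v) = _
      rw [ih, map_smul, h, smul_smul, pow_succ]
  have h2 := (T ^ m).le_of_opNorm_le (hM m) v
  rw [h1, norm_smul, norm_pow] at h2
  have h3 := le_of_mul_le_mul_right h2 (norm_pos_iff.2 hv)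
  linarith

theorem PowerBounded.norm_trace_le {T : V →L[ℂ] V} (hT : PowerBounded T) :
    ‖LinearMap.trace ℂ V (T : V →ₗ[ℂ] V)‖ ≤ Module.finrank ℂ V := by
  rw [Module.End.trace_eq_sum_roots_charpoly_of_splits (IsAlgClosed.splits _)]
  have h1 : ∀ c ∈ (LinearMap.charpoly (T : V →ₗ[ℂ] V)).roots, ‖c‖ ≤ 1 := by
    intro c hc
    have h1 := Polynomial.isRoot_of_mem_roots hc
    rw [← Module.End.hasEigenvalue_iff_isRoot_charpoly] at h1
    obtain ⟨v, hv⟩ := h1.exists_hasEigenvector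
    exact hT.norm_eigenvalue_le hv.2 hv.apply_eq_smul
  have h2 : ∀ s : Multiset ℂ, (∀ c ∈ s, ‖c‖ ≤ 1) → ‖s.sum‖ ≤ s.card := by
    intro s
    induction s using Multiset.induction_on with
    | empty => simp
    | cons a s ih =>
      intro h
      rw [Multiset.sum_cons, Multiset.card_cons, Nat.cast_succ, add_comm (s.card : ℝ)]
      exact (norm_add_le _ _).trans (add_le_add (h a (Multiset.mem_cons_self a s))
        (ih fun c hc => h c (Multiset.mem_cons_of_mem hc)))
  refine (h2 _ h1).trans (Nat.cast_le.2 ?_)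
  rw [← LinearMap.charpoly_natDegree (T : V →ₗ[ℂ] V)]
  exact Polynomial.card_roots' _

/-- `ρ g * ρ h = ρ (g * h)` is power bounded, so its trace is at most the dimension. By Burnside the
traces of `ρ g * φ` are bounded in `g` for every `φ`; rank-one `φ` give matrix coefficients, and
uniform boundedness is applied to functionals, then to vectors. -/
theorem exists_norm_le_of_irreducible {G : Type*} [Monoid G] (ρ : G →* (V →L[ℂ] V))
    (hρ : ∀ g, PowerBounded (ρ g))
    (hirr : ∀ W : Submodule ℂ V, (∀ g, ∀ w ∈ W, ρ g w ∈ W) → W = ⊥ ∨ W = ⊤) :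
    ∃ M, ∀ g, ‖ρ g‖ ≤ M := by
  have : CompleteSpace V := FiniteDimensional.complete ℂ V
  rcases subsingleton_or_nontrivial V with hV | hV
  · exact ⟨0, fun g => by rw [Subsingleton.elim (ρ g) 0, norm_zero]⟩
  let ρ' : G →* Module.End ℂ V :=
    { toFun := fun g => (ρ g : V →ₗ[ℂ] V)
      map_one' := by rw [map_one]; rfl
      map_mul' := fun g h => by rw [map_mul]; rfl }
  have hspan := span_eq_top_of_irreducible ρ' hirr
  have htrace : ∀ φ : Module.End ℂ V, ∃ M, ∀ g, ‖LinearMap.trace ℂ V (ρ' g * φ)‖ ≤ M := by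
    intro φ
    have hφ : φ ∈ Submodule.span ℂ (Set.range ρ') := by rw [hspan]; trivial
    induction hφ using Submodule.span_induction with
    | mem x hx =>
      obtain ⟨h, rfl⟩ := hx
      refine ⟨Module.finrank ℂ V, fun g => ?_⟩
      rw [← map_mul]
      exact (hρ (g * h)).norm_trace_le
    | zero => exact ⟨0, fun g => by simp⟩
    | add x y _ _ hx hy =>
      obtain ⟨M, hM⟩ := hx
      obtain ⟨N, hN⟩ := hy
      refine ⟨M + N, fun g => ?_⟩
      rw [mul_add, map_add]
      exact (norm_add_le _ _).trans (add_le_add (hM g) (hN g))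
    | smul c x _ hx =>
      obtain ⟨M, hM⟩ := hx
      refine ⟨‖c‖ * M, fun g => ?_⟩
      rw [mul_smul_comm, map_smul, norm_smul]
      exact mul_le_mul_of_nonneg_left (hM g) (norm_nonneg c)
  refine banach_steinhaus fun v => ?_
  obtain ⟨C, hC⟩ := banach_steinhaus
    (g := fun g => NormedSpace.inclusionInDoubleDualLi ℂ (ρ g v)) fun f => by
      obtain ⟨M, hM⟩ := htrace (LinearMap.smulRight (f : V →ₗ[ℂ] ℂ) v)
      refine ⟨M, fun g => ?_⟩
      have h1 : ρ' g * LinearMap.smulRight (f : V →ₗ[ℂ] ℂ) v =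
          LinearMap.smulRight (f : V →ₗ[ℂ] ℂ) (ρ g v) := by
        ext w
        change ρ g (f w • v) = f w • ρ g v
        rw [map_smul]
      have h2 := hM g
      rw [h1, LinearMap.trace_smulRight] at h2
      exact h2
  exact ⟨C, fun g => by simpa only [LinearIsometry.norm_map] using hC g⟩

/-- The compression of a representation along a linear inclusion and a retraction. -/
def compression {U G : Type*} [NormedAddCommGroup U] [NormedSpace ℂ U] [Group G]
    (ρ : G →* (V →L[ℂ] V)) (ι : U →L[ℂ] V) (P : V →L[ℂ] U) (hPι : ∀ u, P (ι u) = u)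
    (h : ∀ g g' u, P (ρ g (ι (P (ρ g' (ι u))))) = P (ρ g (ρ g' (ι u)))) : G →* (U →L[ℂ] U) where
  toFun g := P.comp ((ρ g).comp ι)
  map_one' := by
    ext u
    simp [hPι]
  map_mul' g g' := by
    ext u
    simpa using (h g g' u).symm

omit [FiniteDimensional ℂ V] in
theorem powerBounded_compression {U G : Type*} [NormedAddCommGroup U] [NormedSpace ℂ U] [Group G]
    {ρ : G →* (V →L[ℂ] V)} {ι : U →L[ℂ] V} {P : V →L[ℂ] U} {hPι : ∀ u, P (ι u) = u}
    {h : ∀ g g' u, P (ρ g (ι (P (ρ g' (ι u))))) = P (ρ g (ρ g' (ι u)))}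
    {g : G} (hg : PowerBounded (ρ g)) : PowerBounded (compression ρ ι P hPι h g) := by
  obtain ⟨M, hM⟩ := hg
  refine ⟨‖P‖ * (M * ‖ι‖), fun m => ?_⟩
  rw [← map_pow]
  refine (P.opNorm_comp_le _).trans (mul_le_mul_of_nonneg_left
    ((ContinuousLinearMap.opNorm_comp_le _ _).trans (mul_le_mul_of_nonneg_right ?_
      (norm_nonneg _))) (norm_nonneg _))
  rw [map_pow]
  exact hM m

theorem exists_continuous_retraction (W : Submodule ℂ V) :
    ∃ P : V →L[ℂ] W, ∀ w : W, P w = w := by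
  obtain ⟨W', hW'⟩ := W.exists_isCompl
  exact ⟨LinearMap.toContinuousLinearMap (W.projectionOnto W' hW'),
    fun w => Submodule.projectionOnto_apply_left hW' w⟩

/-- Induction on dimension: an irreducible `W` falls under `exists_norm_le_of_irreducible`;
otherwise an equivariant projection `p` splits `W` into `W₁` and `W ⊓ ker p`, both smaller. -/
theorem CompletelyReducible.exists_norm_apply_le {H : Subgroup (V →L[ℂ] V)ˣ}
    (hH : CompletelyReducible H) (hpb : ∀ h ∈ H, PowerBounded (h : V →L[ℂ] V)) (n : ℕ) :
    ∀ W : Submodule ℂ V, Module.finrank ℂ W ≤ n → IsInvariantUnder H W →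
      ∃ M, ∀ h ∈ H, ∀ w ∈ W, ‖(h : V →L[ℂ] V) w‖ ≤ M * ‖w‖ := by
  induction n with
  | zero =>
    intro W hn _
    refine ⟨0, fun h _ w hw => ?_⟩
    rw [Nat.le_zero, Submodule.finrank_eq_zero] at hn
    rw [hn, Submodule.mem_bot] at hw
    simp [hw]
  | succ n ih =>
    intro W hn hW
    by_cases hirr : ∀ W₁ ≤ W, IsInvariantUnder H W₁ → W₁ = ⊥ ∨ W₁ = W
    · let ρ : H →* (V →L[ℂ] V) := (Units.coeHom _).comp H.subtype
      obtain ⟨P, hP⟩ := exists_continuous_retraction W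
      have hPW : ∀ w ∈ W, ((P w : W) : V) = w := fun w hw => congrArg Subtype.val (hP ⟨w, hw⟩)
      have hcomp : ∀ (g g' : H) (u : W), P (ρ g (W.subtypeL (P (ρ g' (W.subtypeL u))))) =
          P (ρ g (ρ g' (W.subtypeL u))) := fun g g' u => by
        have : W.subtypeL (P (ρ g' (W.subtypeL u))) = ρ g' (W.subtypeL u) :=
          hPW _ (hW g' g'.2 u u.2)
        rw [this]
      obtain ⟨M, hM⟩ := exists_norm_le_of_irreducible
        (compression ρ W.subtypeL P hP hcomp)
        (fun g => powerBounded_compression (hpb g g.2)) (fun W₁ hW₁ => by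
          rcases hirr (W₁.map W.subtype) (Submodule.map_subtype_le _ _) (by
            rintro h hh _ ⟨w, hw, rfl⟩
            refine ⟨_, hW₁ ⟨h, hh⟩ w hw, ?_⟩
            exact hPW _ (hW h hh w w.2)) with h | h
          · left
            exact Submodule.map_injective_of_injective W.subtype_injective
              (h.trans (Submodule.map_bot _).symm)
          · right
            refine top_unique fun w _ => ?_
            have h2 : (w : V) ∈ W₁.map W.subtype := h.symm ▸ w.2
            obtain ⟨w', hw', he⟩ := h2
            rwa [← Subtype.ext he])
      refine ⟨M, fun h hh w hw => ?_⟩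
      have h1 := (compression ρ W.subtypeL P hP hcomp ⟨h, hh⟩).le_of_opNorm_le (hM _) ⟨w, hw⟩
      have h2 : ((compression ρ W.subtypeL P hP hcomp ⟨h, hh⟩ ⟨w, hw⟩ : W) : V) =
        (h : V →L[ℂ] V) w := hPW _ (hW h hh w hw)
      rw [← h2]
      exact h1
    · push Not at hirr
      obtain ⟨W₁, hle, hinv, hne, hne'⟩ := hirr
      obtain ⟨p, hp, hc⟩ := hH W₁ hinv
      let W₂ := W ⊓ LinearMap.ker (p : V →ₗ[ℂ] V)
      have hinv₂ : IsInvariantUnder H W₂ := by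
        rintro h hh w ⟨hw, hw'⟩
        refine ⟨hW h hh w hw, ?_⟩
        have h1 : p ((h : V →L[ℂ] V) w) = (h : V →L[ℂ] V) (p w) :=
          (DFunLike.congr_fun (hc hh) w).symm
        change p ((h : V →L[ℂ] V) w) = 0
        rw [h1, show p w = 0 from hw', map_zero]
      have hlt : W₁ < W := lt_of_le_of_ne hle hne'
      have hlt₂ : W₂ < W := by
        refine lt_of_le_of_ne inf_le_left fun h => hne ?_
        refine (Submodule.eq_bot_iff _).2 fun w hw => ?_
        have h1 : w ∈ W₂ := h ▸ hle hw
        rw [← hp.2 w hw]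
        exact h1.2
      obtain ⟨M₁, hM₁⟩ := ih W₁ (by have := Submodule.finrank_lt_finrank_of_lt hlt; omega) hinv
      obtain ⟨M₂, hM₂⟩ := ih W₂ (by have := Submodule.finrank_lt_finrank_of_lt hlt₂; omega) hinv₂
      refine ⟨|M₁| * ‖p‖ + |M₂| * (1 + ‖p‖), fun h hh w hw => ?_⟩
      have h1 := hM₁ h hh (p w) (hp.1 w)
      have h2 := hM₂ h hh (w - p w) ⟨W.sub_mem hw (hle (hp.1 w)), by
        change p (w - p w) = 0
        rw [map_sub, hp.2 _ (hp.1 w), sub_self]⟩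
      have h3 := p.le_opNorm w
      have h4 : (h : V →L[ℂ] V) w = (h : V →L[ℂ] V) (p w) + (h : V →L[ℂ] V) (w - p w) := by
        rw [← map_add, add_sub_cancel]
      have h5 : ‖w - p w‖ ≤ (1 + ‖p‖) * ‖w‖ := by
        refine (norm_sub_le _ _).trans ?_
        linarith
      calc ‖(h : V →L[ℂ] V) w‖ ≤ M₁ * ‖p w‖ + M₂ * ‖w - p w‖ := by
            rw [h4]; exact (norm_add_le _ _).trans (add_le_add h1 h2)
        _ ≤ |M₁| * (‖p‖ * ‖w‖) + |M₂| * ((1 + ‖p‖) * ‖w‖) :=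
            add_le_add (mul_le_mul (le_abs_self _) h3 (norm_nonneg _) (abs_nonneg _))
              (mul_le_mul (le_abs_self _) h5 (norm_nonneg _) (abs_nonneg _))
        _ = _ := by ring

theorem CompletelyReducible.exists_norm_le {H : Subgroup (V →L[ℂ] V)ˣ}
    (hH : CompletelyReducible H) (hpb : ∀ h ∈ H, PowerBounded (h : V →L[ℂ] V)) :
    ∃ M, ∀ h ∈ H, ‖(h : V →L[ℂ] V)‖ ≤ M := by
  obtain ⟨M, hM⟩ := hH.exists_norm_apply_le hpb _ ⊤ le_rfl fun _ _ _ _ => trivial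
  refine ⟨|M|, fun h hh => ContinuousLinearMap.opNorm_le_bound _ (abs_nonneg M) fun v => ?_⟩
  exact (hM h hh v trivial).trans (mul_le_mul_of_nonneg_right (le_abs_self M) (norm_nonneg v))

end PowerBounded

/-! ### Conjugating to a bounded block-diagonal limit -/

section Scaling

open Filter Topology

universe u

/-- The invertible operator acting as `a` and `t • b` on the summands of a decomposition. -/
noncomputable def blockUnit {V W W' : Type*} [NormedAddCommGroup V] [NormedSpace ℂ V]
    [NormedAddCommGroup W] [NormedSpace ℂ W] [NormedAddCommGroup W'] [NormedSpace ℂ W']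
    (i : W →L[ℂ] V) (j : W' →L[ℂ] V) (P : V →L[ℂ] W) (Q : V →L[ℂ] W')
    (hPi : ∀ w, P (i w) = w) (hPj : ∀ w, P (j w) = 0) (hQi : ∀ w, Q (i w) = 0)
    (hQj : ∀ w, Q (j w) = w) (hsum : ∀ v, i (P v) + j (Q v) = v)
    (a : (W →L[ℂ] W)ˣ) (b : (W' →L[ℂ] W')ˣ) (t : ℂ) (ht : t ≠ 0) : (V →L[ℂ] V)ˣ where
  val := i.comp ((a : W →L[ℂ] W).comp P) + t • j.comp ((b : W' →L[ℂ] W').comp Q)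
  inv := i.comp (((a⁻¹ : (W →L[ℂ] W)ˣ) : W →L[ℂ] W).comp P) +
    t⁻¹ • j.comp (((b⁻¹ : (W' →L[ℂ] W')ˣ) : W' →L[ℂ] W').comp Q)
  val_inv := by
    have ha : ∀ w, (a : W →L[ℂ] W) (((a⁻¹ : (W →L[ℂ] W)ˣ) : W →L[ℂ] W) w) = w := fun w =>
      DFunLike.congr_fun a.mul_inv w
    have hb : ∀ w, (b : W' →L[ℂ] W') (((b⁻¹ : (W' →L[ℂ] W')ˣ) : W' →L[ℂ] W') w) = w := fun w =>
      DFunLike.congr_fun b.mul_inv w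
    ext v
    simp [hPi, hPj, hQi, hQj, hsum, ha, hb, ht]
  inv_val := by
    have ha : ∀ w, ((a⁻¹ : (W →L[ℂ] W)ˣ) : W →L[ℂ] W) ((a : W →L[ℂ] W) w) = w := fun w =>
      DFunLike.congr_fun a.inv_mul w
    have hb : ∀ w, ((b⁻¹ : (W' →L[ℂ] W')ˣ) : W' →L[ℂ] W') ((b : W' →L[ℂ] W') w) = w := fun w =>
      DFunLike.congr_fun b.inv_mul w
    ext v
    simp [hPi, hPj, hQi, hQj, hsum, ha, hb, ht]

/-- A pointwise power bounded representation can be conjugated by a sequence of operators so as to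
converge to a bounded family. -/
theorem exists_conj_tendsto_bounded {G : Type*} [Group G] (n : ℕ) :
    ∀ (V : Type u) [NormedAddCommGroup V] [NormedSpace ℂ V] [FiniteDimensional ℂ V]
      (ρ : G →* (V →L[ℂ] V)), Module.finrank ℂ V ≤ n → (∀ g, PowerBounded (ρ g)) →
      ∃ (d : ℕ → (V →L[ℂ] V)ˣ) (φ : G → V →L[ℂ] V),
        (∀ g, Tendsto (fun k => (((d k)⁻¹ : (V →L[ℂ] V)ˣ) : V →L[ℂ] V) * ρ g * d k) atTop
          (𝓝 (φ g))) ∧ ∃ M, ∀ g, ‖φ g‖ ≤ M := by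
  induction n with
  | zero =>
    intro V _ _ _ ρ hn _
    have : Subsingleton V := Module.finrank_zero_iff.1 (Nat.le_zero.1 hn)
    exact ⟨fun _ => 1, fun g => ρ g, fun g => by simp,
      0, fun g => (norm_eq_zero.2 (Subsingleton.elim (ρ g) 0)).le⟩
  | succ n ih =>
    intro V _ _ _ ρ hn hρ
    by_cases hirr : ∀ W : Submodule ℂ V, (∀ g, ∀ w ∈ W, ρ g w ∈ W) → W = ⊥ ∨ W = ⊤
    · exact ⟨fun _ => 1, fun g => ρ g, fun g => by simp, exists_norm_le_of_irreducible ρ hρ hirr⟩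
    push Not at hirr
    obtain ⟨W, hW, hbot, htop⟩ := hirr
    obtain ⟨W', hc⟩ := W.exists_isCompl
    obtain ⟨P, hP⟩ : ∃ P : V →L[ℂ] W, ∀ v, P v = W.projectionOnto W' hc v :=
      ⟨LinearMap.toContinuousLinearMap _, fun v => rfl⟩
    obtain ⟨Q, hQ⟩ : ∃ Q : V →L[ℂ] W', ∀ v, Q v = W'.projectionOnto W hc.symm v :=
      ⟨LinearMap.toContinuousLinearMap _, fun v => rfl⟩
    obtain ⟨i, hi⟩ : ∃ i : W →L[ℂ] V, ∀ w, i w = w := ⟨W.subtypeL, fun _ => rfl⟩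
    obtain ⟨j, hj⟩ : ∃ j : W' →L[ℂ] V, ∀ w, j w = w := ⟨W'.subtypeL, fun _ => rfl⟩
    have hPi : ∀ w, P (i w) = w := fun w => by
      rw [hP, hi, Submodule.projectionOnto_apply_left]
    have hQj : ∀ w, Q (j w) = w := fun w => by
      rw [hQ, hj, Submodule.projectionOnto_apply_left]
    have hPj : ∀ w, P (j w) = 0 := fun w => by
      rw [hP, hj, Submodule.projectionOnto_apply_right]
    have hQi : ∀ w, Q (i w) = 0 := fun w => by
      rw [hQ, hi, Submodule.projectionOnto_apply_right]
    have hsum : ∀ v, i (P v) + j (Q v) = v := fun v => by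
      obtain ⟨w, hw, w', hw', rfl⟩ := Submodule.mem_sup.1
        (show v ∈ W ⊔ W' by rw [hc.sup_eq_top]; trivial)
      have h1 := hPi ⟨w, hw⟩
      have h2 := hPj ⟨w', hw'⟩
      have h3 := hQi ⟨w, hw⟩
      have h4 := hQj ⟨w', hw'⟩
      rw [hi] at h1 h3
      rw [hj] at h2 h4
      simp only at h1 h2 h3 h4
      rw [map_add P, map_add Q, h1, h2, h3, h4, add_zero, zero_add, hi, hj]
    have hfix : ∀ g w, i (P (ρ g (i w))) = ρ g (i w) := fun g w => by
      have h1 : ρ g (i w) ∈ W := by rw [hi]; exact hW g w w.2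
      have h2 := hPi ⟨_, h1⟩
      rw [hi] at h2
      simp only at h2
      rw [h2, hi]
    have hQρ : ∀ g w, Q (ρ g (i w)) = 0 := fun g w => by rw [← hfix, hQi]
    have hcompP : ∀ g g' w, P (ρ g (i (P (ρ g' (i w))))) = P (ρ g (ρ g' (i w))) :=
      fun g g' w => by rw [hfix]
    have hcompQ : ∀ g g' w, Q (ρ g (j (Q (ρ g' (j w))))) = Q (ρ g (ρ g' (j w))) :=
      fun g g' w => by
        conv_rhs => rw [← hsum (ρ g' (j w)), map_add, map_add, hQρ, zero_add]
    have hfr := Submodule.finrank_add_eq_of_isCompl hc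
    have hWpos : 0 < Module.finrank ℂ W :=
      Nat.pos_of_ne_zero fun h => hbot (Submodule.finrank_eq_zero.1 h)
    have hWlt : Module.finrank ℂ W < Module.finrank ℂ V := Submodule.finrank_lt htop
    obtain ⟨d, φ, hφ, M, hM⟩ := ih W (compression ρ i P hPi hcompP) (by omega)
      fun g => powerBounded_compression (hρ g)
    obtain ⟨e, ψ, hψ, N, hN⟩ := ih W' (compression ρ j Q hQj hcompQ) (by omega)
      fun g => powerBounded_compression (hρ g)
    let r : ℕ → ℝ := fun k => ‖(((d k)⁻¹ : (W →L[ℂ] W)ˣ) : W →L[ℂ] W)‖ * ‖(e k : W' →L[ℂ] W')‖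
    have hr : ∀ k, 0 ≤ r k := fun k => by positivity
    -- The off-diagonal block of the conjugate is `t k` times a term of size `O(r k)`, so this scale
    -- sends it to 0 however fast `d k` and `e k` degenerate.
    let t : ℕ → ℝ := fun k => 1 / ((k : ℝ) + 1) / (1 + r k)
    have ht : ∀ k, 0 < t k := fun k => by have := hr k; positivity
    have htr : ∀ k, t k * r k ≤ 1 / ((k : ℝ) + 1) := fun k => by
      have h1 := hr k
      have h2 : r k / (1 + r k) ≤ 1 := by rw [div_le_one (by linarith)]; linarith
      calc t k * r k = 1 / ((k : ℝ) + 1) * (r k / (1 + r k)) := by simp only [t]; ring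
        _ ≤ 1 / ((k : ℝ) + 1) * 1 := mul_le_mul_of_nonneg_left h2 (by positivity)
        _ = _ := mul_one _
    refine ⟨fun k => blockUnit i j P Q hPi hPj hQi hQj hsum (d k) (e k) (t k)
      (Complex.ofReal_ne_zero.2 (ht k).ne'), fun g => i.comp ((φ g).comp P) + j.comp ((ψ g).comp Q),
      fun g => ?_, ‖i‖ * (M * ‖P‖) + ‖j‖ * (N * ‖Q‖), fun g => ?_⟩
    · let B : ℕ → V →L[ℂ] V := fun k => (t k : ℂ) • i.comp
        ((((d k)⁻¹ : (W →L[ℂ] W)ˣ) : W →L[ℂ] W).comp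
          (P.comp ((ρ g).comp (j.comp ((e k : W' →L[ℂ] W').comp Q)))))
      have hB : Tendsto B atTop (𝓝 0) := by
        refine squeeze_zero_norm (a := fun k : ℕ =>
          1 / ((k : ℝ) + 1) * (‖i‖ * ‖P‖ * ‖ρ g‖ * ‖j‖ * ‖Q‖)) (fun k => ?_) ?_
        · have h1 : ‖i.comp ((((d k)⁻¹ : (W →L[ℂ] W)ˣ) : W →L[ℂ] W).comp
              (P.comp ((ρ g).comp (j.comp ((e k : W' →L[ℂ] W').comp Q)))))‖ ≤
              ‖i‖ * (‖(((d k)⁻¹ : (W →L[ℂ] W)ˣ) : W →L[ℂ] W)‖ *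
                (‖P‖ * (‖ρ g‖ * (‖j‖ * (‖(e k : W' →L[ℂ] W')‖ * ‖Q‖))))) := by
            refine (ContinuousLinearMap.opNorm_comp_le _ _).trans ?_
            gcongr
            refine (ContinuousLinearMap.opNorm_comp_le _ _).trans ?_
            gcongr
            refine (ContinuousLinearMap.opNorm_comp_le _ _).trans ?_
            gcongr
            refine (ContinuousLinearMap.opNorm_comp_le _ _).trans ?_
            gcongr
            refine (ContinuousLinearMap.opNorm_comp_le _ _).trans ?_
            gcongr
            exact ContinuousLinearMap.opNorm_comp_le _ _
          calc ‖B k‖ = t k * _ := by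
                rw [norm_smul, Complex.norm_real, Real.norm_of_nonneg (ht k).le]
            _ ≤ t k * _ := mul_le_mul_of_nonneg_left h1 (ht k).le
            _ = t k * r k * (‖i‖ * ‖P‖ * ‖ρ g‖ * ‖j‖ * ‖Q‖) := by simp only [r]; ring
            _ ≤ _ := mul_le_mul_of_nonneg_right (htr k) (by positivity)
        · simpa using (tendsto_one_div_add_atTop_nhds_zero_nat (𝕜 := ℝ)).mul_const
            (‖i‖ * ‖P‖ * ‖ρ g‖ * ‖j‖ * ‖Q‖)
      have hX : Tendsto (fun k => i.comp (((((d k)⁻¹ : (W →L[ℂ] W)ˣ) : W →L[ℂ] W) *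
          compression ρ i P hPi hcompP g * d k).comp P)) atTop (𝓝 (i.comp ((φ g).comp P))) :=
        ((continuous_const.clm_comp (continuous_id.clm_comp continuous_const)).tendsto
          (φ g)).comp (hφ g)
      have hY : Tendsto (fun k => j.comp (((((e k)⁻¹ : (W' →L[ℂ] W')ˣ) : W' →L[ℂ] W') *
          compression ρ j Q hQj hcompQ g * e k).comp Q)) atTop (𝓝 (j.comp ((ψ g).comp Q))) :=
        ((continuous_const.clm_comp (continuous_id.clm_comp continuous_const)).tendsto
          (ψ g)).comp (hψ g)
      have hXY := (hX.add hB).add hY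
      rw [add_zero] at hXY
      refine hXY.congr fun k => ?_
      have htk : (t k : ℂ) ≠ 0 := Complex.ofReal_ne_zero.2 (ht k).ne'
      ext v
      simp [B, blockUnit, compression, hQρ]
      exact (inv_smul_smul₀ htk _).symm
    · refine (norm_add_le _ _).trans (add_le_add ?_ ?_)
      · refine (ContinuousLinearMap.opNorm_comp_le _ _).trans ?_
        gcongr
        refine (ContinuousLinearMap.opNorm_comp_le _ _).trans ?_
        gcongr
        exact hM g
      · refine (ContinuousLinearMap.opNorm_comp_le _ _).trans ?_
        gcongr
        refine (ContinuousLinearMap.opNorm_comp_le _ _).trans ?_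
        gcongr
        exact hN g

end Scaling

/-! ### Boundedness of closed groups of power bounded operators -/

section ClosedSubgroup

open Filter Topology

theorem mem_iterCommutators_of_mapsTo {G Q : Type*} [Group G] [Group Q] (f : G →* Q) {S : Set G}
    {T : Set Q} (h : ∀ s ∈ S, f s ∈ T) (n : ℕ) :
    ∀ x ∈ iterCommutators S n, f x ∈ iterCommutators T n := by
  induction n with
  | zero => exact h
  | succ n ih =>
    rintro _ ⟨x, hx, s, hs, rfl⟩
    exact ⟨f x, ih x hx, f s, h s hs, map_commutatorElement f x s⟩

theorem iterCommutators_subset {G : Type*} [Group G] {S : Set G} {H : Subgroup G} (h : S ⊆ H)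
    (n : ℕ) : iterCommutators S n ⊆ H := by
  induction n with
  | zero => exact h
  | succ n ih =>
    rintro _ ⟨x, hx, s, hs, rfl⟩
    exact H.mul_mem (H.mul_mem (H.mul_mem (ih hx) (h hs)) (H.inv_mem (ih hx))) (H.inv_mem (h hs))

variable {V : Type*} [NormedAddCommGroup V] [NormedSpace ℂ V] [FiniteDimensional ℂ V]

/-- Modulo `C` the iterated commutators of the generators die at level `k`, so the quotient is
nilpotent; `htors` makes it torsion. -/
theorem CompletelyReducible.closure_sup {C G : Subgroup (V →L[ℂ] V)ˣ} (hC : CompletelyReducible C)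
    (hCG : C ≤ G) (hnorm : ∀ g ∈ G, ∀ c ∈ C, g * c * g⁻¹ ∈ C)
    (htors : ∀ g ∈ G, ∃ n, 0 < n ∧ g ^ n ∈ C) {S : Set (V →L[ℂ] V)ˣ} (hS : S ⊆ G) {k : ℕ}
    (hk : iterCommutators S k ⊆ C) : CompletelyReducible (Subgroup.closure S ⊔ C) := by
  set Γ := Subgroup.closure S ⊔ C
  have hΓG : Γ ≤ G := sup_le ((Subgroup.closure_le _).2 hS) hCG
  let N := C.subgroupOf Γ
  have hNn : N.Normal := ⟨fun c hc g => hnorm g (hΓG g.2) c hc⟩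
  let T : Set Γ := {x | (x : (V →L[ℂ] V)ˣ) ∈ S}
  have hT : Subgroup.closure (QuotientGroup.mk' N '' T) = ⊤ := by
    let H := ((Subgroup.closure (QuotientGroup.mk' N '' T)).comap
      (QuotientGroup.mk' N)).map Γ.subtype
    have h1 : Γ ≤ H := by
      refine sup_le ((Subgroup.closure_le _).2 fun s hs => ?_) fun c hc => ?_
      · have hs' : s ∈ Γ := (le_sup_left : _ ≤ Γ) (Subgroup.subset_closure hs)
        exact ⟨⟨s, hs'⟩, Subgroup.subset_closure ⟨⟨s, hs'⟩, hs, rfl⟩, rfl⟩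
      · have hc' : c ∈ Γ := (le_sup_right : _ ≤ Γ) hc
        refine ⟨⟨c, hc'⟩, ?_, rfl⟩
        have h2 : ((⟨c, hc'⟩ : Γ) : Γ ⧸ N) = 1 := (QuotientGroup.eq_one_iff _).2 hc
        change ((⟨c, hc'⟩ : Γ) : Γ ⧸ N) ∈ Subgroup.closure (QuotientGroup.mk' N '' T)
        rw [h2]
        exact one_mem _
    refine top_unique fun q _ => ?_
    induction q using QuotientGroup.induction_on with
    | H x =>
      obtain ⟨y, hy, hyx⟩ := h1 x.2
      rw [← Subtype.ext hyx]
      exact hy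
  have hnil : Group.IsNilpotent (Γ ⧸ N) := isNilpotent_of_iterCommutators hT (k := k) (by
    intro z hz
    obtain ⟨x, hx, rfl⟩ := map_iterCommutators (QuotientGroup.mk' N) T k z hz
    exact (QuotientGroup.eq_one_iff x).2
      (hk (mem_iterCommutators_of_mapsTo Γ.subtype (fun s hs => hs) k x hx)))
  have hNC : N.map Γ.subtype = C := by
    rw [Subgroup.subgroupOf_map_subtype, inf_eq_left]
    exact le_sup_right
  have h := CompletelyReducible.of_isNilpotent_quotient Γ.subtype N (by rwa [hNC]) fun g => by
    obtain ⟨n, hn, h⟩ := htors g (hΓG g.2)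
    exact ⟨n, hn, h⟩
  rwa [Subgroup.range_subtype] at h

/-- By compactness two powers of `g` are close; dividing by the smaller one costs only the bound
`M'` on powers of the inverse. -/
theorem exists_pow_near_one {g : (V →L[ℂ] V)ˣ} (hg : PowerBounded (g : V →L[ℂ] V))
    (hg' : PowerBounded ((g⁻¹ : (V →L[ℂ] V)ˣ) : V →L[ℂ] V)) {δ : ℝ} (hδ : 0 < δ) :
    ∃ n, 0 < n ∧ ‖((g ^ n : (V →L[ℂ] V)ˣ) : V →L[ℂ] V) - 1‖ < δ := by
  obtain ⟨M, hM⟩ := hg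
  obtain ⟨M', hM'⟩ := hg'
  have : ProperSpace (V →L[ℂ] V) := FiniteDimensional.proper ℂ _
  have hM0 : 0 ≤ M' := (norm_nonneg _).trans (hM' 0)
  obtain ⟨a, -, φ, hφ, ha⟩ := (isCompact_closedBall (0 : V →L[ℂ] V) M).tendsto_subseq
    (x := fun m : ℕ => (g : V →L[ℂ] V) ^ m) fun m => mem_closedBall_zero_iff.2 (hM m)
  obtain ⟨N, hN⟩ := Metric.cauchySeq_iff.1 ha.cauchySeq (δ / (M' + 1)) (by positivity)
  have h1 := hN (N + 1) (Nat.le_succ N) N le_rfl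
  have hlt := hφ (Nat.lt_succ_self N)
  refine ⟨φ (N + 1) - φ N, Nat.sub_pos_of_lt hlt, ?_⟩
  have e : ((g ^ (φ (N + 1) - φ N) : (V →L[ℂ] V)ˣ) : V →L[ℂ] V) - 1 =
      ((g⁻¹ : (V →L[ℂ] V)ˣ) : V →L[ℂ] V) ^ φ N *
        ((g : V →L[ℂ] V) ^ φ (N + 1) - (g : V →L[ℂ] V) ^ φ N) := by
    have h2 : g ^ (φ (N + 1) - φ N) = g⁻¹ ^ φ N * g ^ φ (N + 1) := by
      rw [pow_sub _ hlt.le, inv_pow]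
      exact ((Commute.refl g).pow_pow _ _).inv_right
    have h3 : g⁻¹ ^ φ N * g ^ φ N = 1 := by rw [inv_pow, inv_mul_cancel]
    rw [mul_sub, ← Units.val_pow_eq_pow_val, ← Units.val_pow_eq_pow_val,
      ← Units.val_pow_eq_pow_val, ← Units.val_mul, ← Units.val_mul, h2, h3, Units.val_one]
  rw [e]
  rw [dist_eq_norm] at h1
  calc _ ≤ M' * (δ / (M' + 1)) := (norm_mul_le _ _).trans
        (mul_le_mul (hM' _) h1.le (norm_nonneg _) hM0)
    _ < δ := by
        rw [mul_div_assoc', div_lt_iff₀ (by positivity)]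
        nlinarith

theorem exists_finite_of_mem_closure_sup {G : Type*} [Group G] {U : Set G} {C : Subgroup G} {h : G}
    (hh : h ∈ Subgroup.closure U ⊔ C) :
    ∃ S : Set G, S.Finite ∧ S ⊆ U ∧ h ∈ Subgroup.closure S ⊔ C := by
  have mono : ∀ {S T : Set G}, S ⊆ T → Subgroup.closure S ⊔ C ≤ Subgroup.closure T ⊔ C :=
    fun h => sup_le_sup_right (Subgroup.closure_mono h) C
  rw [← Subgroup.closure_eq C, ← Subgroup.closure_union] at hh
  induction hh using Subgroup.closure_induction with
  | mem x hx =>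
    rcases hx with hx | hx
    · exact ⟨{x}, Set.finite_singleton x, Set.singleton_subset_iff.2 hx,
        (le_sup_left : _ ≤ Subgroup.closure {x} ⊔ C) (Subgroup.subset_closure rfl)⟩
    · exact ⟨∅, Set.finite_empty, Set.empty_subset _, (le_sup_right : _ ≤ _ ⊔ C) hx⟩
  | one => exact ⟨∅, Set.finite_empty, Set.empty_subset _, one_mem _⟩
  | mul x y _ _ hx hy =>
    obtain ⟨S, hS, hSU, hxS⟩ := hx
    obtain ⟨T, hT, hTU, hyT⟩ := hy
    exact ⟨S ∪ T, hS.union hT, Set.union_subset hSU hTU,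
      mul_mem (mono Set.subset_union_left hxS) (mono Set.subset_union_right hyT)⟩
  | inv x _ hx =>
    obtain ⟨S, hS, hSU, hxS⟩ := hx
    exact ⟨S, hS, hSU, inv_mem hxS⟩

/-- Some finite `S` already gives the maximal operator span, and each element involves only finitely
many members of `U`. -/
theorem CompletelyReducible.closure_sup_of_finite {U : Set (V →L[ℂ] V)ˣ}
    {C : Subgroup (V →L[ℂ] V)ˣ} (h : ∀ S : Set (V →L[ℂ] V)ˣ, S.Finite → S ⊆ U →
      CompletelyReducible (Subgroup.closure S ⊔ C)) :
    CompletelyReducible (Subgroup.closure U ⊔ C) := by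
  obtain ⟨_, ⟨S, hS, hSU, rfl⟩, hmax⟩ := exists_maximal_operatorSpan
    (fun K => ∃ S : Set (V →L[ℂ] V)ˣ, S.Finite ∧ S ⊆ U ∧ K = Subgroup.closure S ⊔ C)
    ⟨∅, Set.finite_empty, Set.empty_subset U, rfl⟩
  refine (h S hS hSU).of_subset_span (sup_le_sup_right (Subgroup.closure_mono hSU) C)
    fun u hu => ?_
  obtain ⟨T, hT, hTU, huT⟩ := exists_finite_of_mem_closure_sup hu
  exact hmax _ ⟨S ∪ T, hS.union hT, Set.union_subset hSU hTU, rfl⟩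
    (sup_le_sup_right (Subgroup.closure_mono Set.subset_union_left) C) u
    ((sup_le_sup_right (Subgroup.closure_mono Set.subset_union_right) C :
      Subgroup.closure T ⊔ C ≤ _) huT)

/-- Pigeonhole: coset representatives whose images share a small ball differ by an element with
image near 1, hence represent the same coset. -/
theorem finite_quotient_of_bounded {G : Subgroup (V →L[ℂ] V)ˣ} {H : Subgroup (V →L[ℂ] V)ˣ}
    (φ : G →* (V →L[ℂ] V)) {M : ℝ} (hM : ∀ g, ‖φ g‖ ≤ M) {ε : ℝ} (hε : 0 < ε)
    (hH : ∀ g : G, ‖φ g - 1‖ < ε → (g : (V →L[ℂ] V)ˣ) ∈ H) : Finite (G ⧸ H.subgroupOf G) := by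
  have : ProperSpace (V →L[ℂ] V) := FiniteDimensional.proper ℂ _
  have hM0 : 0 ≤ M := (norm_nonneg _).trans (hM 1)
  obtain ⟨t, ht, hcov⟩ := Metric.totallyBounded_iff.1
    (isCompact_closedBall (0 : V →L[ℂ] V) M).totallyBounded (ε / (2 * (M + 1))) (by positivity)
  have hex : ∀ q : G ⧸ H.subgroupOf G, ∃ y : t, dist (φ q.out) y < ε / (2 * (M + 1)) := by
    intro q
    have h1 := hcov (mem_closedBall_zero_iff.2 (hM q.out))
    simp only [Set.mem_iUnion, Metric.mem_ball] at h1
    obtain ⟨y, hy, h⟩ := h1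
    exact ⟨⟨y, hy⟩, h⟩
  choose f hf using hex
  have := ht.to_subtype
  refine Finite.of_injective f fun a b hab => ?_
  rw [← QuotientGroup.out_eq' a, ← QuotientGroup.out_eq' b, QuotientGroup.eq]
  refine hH (a.out⁻¹ * b.out) ?_
  have h1 : φ (a.out⁻¹ * b.out) - 1 = φ a.out⁻¹ * (φ b.out - φ a.out) := by
    rw [mul_sub, ← map_mul, ← map_mul, inv_mul_cancel, map_one]
  have h2 : ‖φ b.out - φ a.out‖ < ε / (M + 1) := by
    rw [← dist_eq_norm]
    have h3 := hf a
    have h4 := hf b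
    rw [← hab] at h4
    have h5 := dist_triangle_right (φ b.out) (φ a.out) (f a)
    have h6 : ε / (2 * (M + 1)) + ε / (2 * (M + 1)) = ε / (M + 1) := by
      field_simp
      ring
    linarith
  rw [h1]
  calc _ ≤ M * (ε / (M + 1)) := (norm_mul_le _ _).trans
        (mul_le_mul (hM _) h2.le (norm_nonneg _) hM0)
    _ < ε := by
        rw [mul_div_assoc', div_lt_iff₀ (by positivity)]
        nlinarith

/-- A closed group of operators, each of which is power bounded, is bounded. -/
theorem exists_norm_le_of_isClosed {G : Subgroup (V →L[ℂ] V)ˣ}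
    (hG : IsClosed (G : Set (V →L[ℂ] V)ˣ)) (hpb : ∀ g ∈ G, PowerBounded (g : V →L[ℂ] V)) :
    ∃ M, ∀ g ∈ G, ‖(g : V →L[ℂ] V)‖ ≤ M := by
  have : CompleteSpace (V →L[ℂ] V) := FiniteDimensional.complete ℂ _
  obtain ⟨d, φ, hφ, M, hM⟩ := exists_conj_tendsto_bounded _ V
    ((Units.coeHom _).comp G.subtype) le_rfl fun g => hpb g g.2
  -- Limits of conjugates of a homomorphism are multiplicative.
  let ψ : G →* (V →L[ℂ] V) :=
    { toFun := φ
      map_one' := by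
        refine tendsto_nhds_unique (hφ 1) ?_
        simp
      map_mul' := fun g h => by
        refine tendsto_nhds_unique (hφ (g * h)) (((hφ g).mul (hφ h)).congr fun k => ?_)
        rw [map_mul]
        simp only [mul_assoc, Units.mul_inv_cancel_left] }
  set C := connectedPart G
  obtain ⟨δ, hδ, hCδ⟩ := exists_forall_norm_lt_mem_connectedPart hG
  have hCG : C ≤ G := connectedPart_le hG
  let U : Set (V →L[ℂ] V)ˣ := {u | ∃ g : G, (g : (V →L[ℂ] V)ˣ) = u ∧ ‖ψ g - 1‖ < 1 / 16}
  have hUG : U ⊆ G := by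
    rintro _ ⟨g, rfl, -⟩
    exact g.2
  have hH : CompletelyReducible (Subgroup.closure U ⊔ C) := by
    refine .closure_sup_of_finite fun S hS hSU => ?_
    -- Finiteness of `S` gives one conjugator `d k` that works for all its elements; 1/16 is the
    -- contraction radius.
    have hev : ∀ᶠ k in atTop, ∀ s ∈ S,
        ‖(((d k)⁻¹ * s * d k : (V →L[ℂ] V)ˣ) : V →L[ℂ] V) - 1‖ ≤ 1 / 16 := by
      rw [Filter.eventually_all_finite hS]
      intro s hs
      obtain ⟨g, rfl, hg⟩ := hSU hs
      exact (((hφ g).sub_const 1).norm.eventually (gt_mem_nhds hg)).mono fun k hk => hk.le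
    obtain ⟨k, hk⟩ := hev.exists
    obtain ⟨K, hK⟩ := exists_iterCommutators_small ContinuousLinearMap.norm_id_le (d k) hk hδ
    exact (completelyReducible_connectedPart hG hpb).closure_sup hCG
      (fun g hg c hc => conj_mem_connectedPart hg hc)
      (fun g hg => by
        obtain ⟨n, hn, h⟩ := exists_pow_near_one (hpb g hg) (hpb _ (G.inv_mem hg)) hδ
        exact ⟨n, hn, hCδ _ (G.pow_mem hg n) h⟩) (hSU.trans hUG) (k := K)
      fun x hx => hCδ x (iterCommutators_subset (hSU.trans hUG) K hx) (hK x hx)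
  have hfin : Finite (G ⧸ (Subgroup.closure U ⊔ C).subgroupOf G) :=
    finite_quotient_of_bounded ψ hM (by norm_num : (0 : ℝ) < 1 / 16) fun g hg =>
      (le_sup_left : _ ≤ Subgroup.closure U ⊔ C) (Subgroup.subset_closure ⟨g, rfl, hg⟩)
  exact (hH.of_finite_quotient (sup_le ((Subgroup.closure_le _).2 hUG) hCG)).exists_norm_le hpb

end ClosedSubgroup

/-! ### From semigroup to group, and compactness -/

section Semigroup

open Filter Topology

/-- Powers return near a cluster point, so quotients of two such powers approach 1, and one factor
fewer approaches `T⁻¹`. -/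
theorem inv_mem_of_isCompact_closure_pow {X : Type*} [Group X] [TopologicalSpace X]
    [IsTopologicalGroup X] {S : Subsemigroup X} (hS : IsClosed (S : Set X)) {T : X} (hT : T ∈ S)
    (hcpt : IsCompact (closure {A : X | ∃ m : ℕ, 1 ≤ m ∧ A = T ^ m})) : T⁻¹ ∈ S := by
  have hpow : ∀ m : ℕ, T ^ (m + 1) ∈ S := by
    intro m
    induction m with
    | zero => simpa using hT
    | succ m ih =>
      rw [pow_succ]
      exact S.mul_mem ih hT
  obtain ⟨a, -, ha⟩ := hcpt.exists_mapClusterPt (f := atTop) (u := fun m : ℕ => T ^ (m + 1))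
    (tendsto_principal.2 (Eventually.of_forall fun m =>
      subset_closure ⟨m + 1, Nat.le_add_left 1 m, rfl⟩))
  rw [← SetLike.mem_coe, ← hS.closure_eq, mem_closure_iff_nhds]
  intro U hU
  have hcont : Tendsto (fun p : X × X => p.1⁻¹ * p.2 * T⁻¹) (𝓝 a ×ˢ 𝓝 a) (𝓝 T⁻¹) := by
    have h : Continuous fun p : X × X => p.1⁻¹ * p.2 * T⁻¹ := by fun_prop
    have := h.tendsto (a, a)
    rwa [inv_mul_cancel, one_mul, nhds_prod_eq] at this
  obtain ⟨W, hW, hWU⟩ := mem_prod_same_iff.1 (hcont hU)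
  have hfreq := mapClusterPt_iff_frequently.1 ha W hW
  obtain ⟨m, hm⟩ := hfreq.exists
  -- The gap of 2 keeps the exponent `l - m - 1` at least 1, so the power lies in `S`.
  obtain ⟨l, hl, hlW⟩ := frequently_atTop.1 hfreq (m + 2)
  refine ⟨T ^ (l - m - 2 + 1), ?_, hpow _⟩
  have h := hWU (Set.mk_mem_prod hm hlW)
  have e : (T ^ (m + 1))⁻¹ * T ^ (l + 1) * T⁻¹ = T ^ (l - m - 2 + 1) := by
    obtain ⟨j, rfl⟩ := Nat.exists_eq_add_of_le hl
    have : m + 2 + j - m - 2 + 1 = j + 1 := by omega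
    rw [this, show m + 2 + j + 1 = (m + 1) + (j + 1) + 1 by omega, pow_succ, pow_add]
    group
  change (T ^ (m + 1))⁻¹ * T ^ (l + 1) * T⁻¹ ∈ U at h
  rwa [e] at h

/-- The units embed as a closed set of pairs `(g, g⁻¹)`, and in a group the bound covers both
coordinates. -/
theorem isCompact_of_norm_le {A : Type*} [NormedRing A] [ProperSpace A] {G : Subgroup Aˣ}
    (hG : IsClosed (G : Set Aˣ)) {M : ℝ} (hM : ∀ g ∈ G, ‖(g : A)‖ ≤ M) :
    IsCompact (G : Set Aˣ) := by
  have h1 : IsCompact (Units.embedProduct A ⁻¹' (Metric.closedBall 0 M ×ˢ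
      (MulOpposite.op '' Metric.closedBall (0 : A) M))) :=
    Units.isClosedEmbedding_embedProduct.isCompact_preimage
      ((isCompact_closedBall 0 M).prod
        ((isCompact_closedBall 0 M).image MulOpposite.continuous_op))
  refine h1.of_isClosed_subset hG fun g hg => ⟨mem_closedBall_zero_iff.2 (hM g hg),
    _, mem_closedBall_zero_iff.2 (hM _ (G.inv_mem hg)), rfl⟩

end Semigroup

theorem proposition2 (n : ℕ) (S : Subsemigroup (Matrix.GeneralLinearGroup (Fin n) ℂ))
    (hne : (S : Set (Matrix.GeneralLinearGroup (Fin n) ℂ)).Nonempty)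
    (hclosed : IsClosed (S : Set (Matrix.GeneralLinearGroup (Fin n) ℂ)))
    (hcpt : ∀ T ∈ S, IsCompact
      (closure {A : Matrix.GeneralLinearGroup (Fin n) ℂ | ∃ m : ℕ, 1 ≤ m ∧ A = T ^ m})) :
    (∃ G : Subgroup (Matrix.GeneralLinearGroup (Fin n) ℂ),
      (G : Set (Matrix.GeneralLinearGroup (Fin n) ℂ)) = S) ∧
    IsCompact (S : Set (Matrix.GeneralLinearGroup (Fin n) ℂ)) := by
  have hinv : ∀ T ∈ S, T⁻¹ ∈ S := fun T hT =>
    inv_mem_of_isCompact_closure_pow hclosed hT (hcpt T hT)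
  let G : Subgroup (Matrix.GeneralLinearGroup (Fin n) ℂ) :=
    { carrier := S
      mul_mem' := fun ha hb => S.mul_mem ha hb
      one_mem' := by
        obtain ⟨T, hT⟩ := hne
        rw [← mul_inv_cancel T]
        exact S.mul_mem hT (hinv T hT)
      inv_mem' := fun h => hinv _ h }
  refine ⟨⟨G, rfl⟩, ?_⟩
  let e : Matrix (Fin n) (Fin n) ℂ ≃ₐ[ℂ]
      (EuclideanSpace ℂ (Fin n) →L[ℂ] EuclideanSpace ℂ (Fin n)) :=
    (Matrix.toEuclideanCLM (n := Fin n) (𝕜 := ℂ)).toAlgEquiv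
  have he : Continuous e := e.toLinearMap.continuous_of_finiteDimensional
  have he' : Continuous e.symm := e.symm.toLinearMap.continuous_of_finiteDimensional
  let E : Matrix.GeneralLinearGroup (Fin n) ℂ ≃*
      (EuclideanSpace ℂ (Fin n) →L[ℂ] EuclideanSpace ℂ (Fin n))ˣ := Units.mapEquiv e.toMulEquiv
  have hE : Continuous E := Continuous.units_map _ he
  have hE' : Continuous E.symm := Continuous.units_map _ he'
  have hGE : ((G.map E.toMonoidHom : Subgroup _) :
      Set (EuclideanSpace ℂ (Fin n) →L[ℂ] EuclideanSpace ℂ (Fin n))ˣ) = E.symm ⁻¹' S :=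
    E.toEquiv.image_eq_preimage_symm S
  have hGclosed := hclosed.preimage hE'
  rw [← hGE] at hGclosed
  obtain ⟨M, hM⟩ := exists_norm_le_of_isClosed hGclosed (by
    rintro _ ⟨T, hT, rfl⟩
    obtain ⟨M, hM⟩ := (hcpt T hT).exists_bound_of_continuousOn
      (Units.continuous_val.comp hE).continuousOn
    -- The zeroth power is not among the powers in `hcpt`, so its norm is added by hand.
    refine ⟨max M ‖(1 : EuclideanSpace ℂ (Fin n) →L[ℂ] EuclideanSpace ℂ (Fin n))‖, fun m => ?_⟩
    rcases Nat.eq_zero_or_pos m with rfl | hm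
    · rw [pow_zero]
      exact le_max_right _ _
    · refine le_trans ?_ (le_max_left _ _)
      have := hM (T ^ m) (subset_closure ⟨m, hm, rfl⟩)
      rwa [Function.comp_apply, map_pow, Units.val_pow_eq_pow_val] at this)
  have : ProperSpace (EuclideanSpace ℂ (Fin n) →L[ℂ] EuclideanSpace ℂ (Fin n)) :=
    FiniteDimensional.proper ℂ _
  have hc := (isCompact_of_norm_le hGclosed hM).image hE'
  rw [hGE, Set.image_preimage_eq _ E.symm.surjective] at hc
  exact hc
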